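/- Let $\phi$ be a real-valued function that is $C^\infty$ in a neighbourhood of the origin of $\mathbb{R}^2$. For a smooth function $f$ near the origin let $\mathcal T(f)$ be the set of $\alpha\in\mathbb{Z}_+^2\setminus\{(0,0)\}$ with $\partial_1^{\alpha_1}\partial_2^{\alpha_2}f(0,0)\neq0$, let the Newton polyhedron $\mathcal N(f)$ be the convex hull of $\bigcup_{\alpha\in\mathcal T(f)}(\alpha+\mathbb{R}_+^2)$, and let the Newton distance $d(f)\in(0,\infty]$ be the number $d$ for which the line $t_1=t_2$ meets the boundary of $\mathcal N(f)$ at $(d,d)$ ($d(f)=\infty$ if $\mathcal N(f)=\emptyset$). The height is $h(f)=\sup_\Psi d(f\circ\Psi)$ over all smooth local diffeomorphisms $\Psi$ at the origin with $\Psi(0)=0$, and the linear height is $h_{lin}(f)=\sup_{L\in GL(\mathbb{R}^2)}d(f\circ L)$. For $m\in\mathbb{N}$ and $n\in\mathbb{N}\cup\{\infty\}$ say that $\phi$ satisfies $(D_{m,n})$ if there are an invertible linear map $L$ of $\mathbb{R}^2$ and functions $b(x_1,x_2)$, $\omega(x_1)$, $b_0(x_1)$, smooth near the origin, such that in a neighbourhood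 of the origin $$\phi(L(x_1,x_2))=b(x_1,x_2)\,(x_2-x_1^m\omega(x_1))^2+b_0(x_1),$$ where $b(0,0)=0$, $\partial_1b(0,0)\neq0$, $\partial_2b(0,0)=0$, $m\ge2$, $\omega(0)\neq0$, $2m+1<n$, and either $n<\infty$ and $b_0(x_1)=x_1^n\beta(x_1)$ near $0$ with $\beta$ smooth and $\beta(0)\neq0$, or $n=\infty$ and $b_0$ is flat at $0$ (all its derivatives vanish at $0$). (1) Suppose $\partial_1^{\alpha_1}\partial_2^{\alpha_2}\phi(0,0)=0$ for all $\alpha\in\mathbb{Z}_+^2$ with $|\alpha|\le2$, $h(\phi)\le2$ and $h_{lin}(\phi)<h(\phi)$. Then $\phi$ satisfies $(D_{m,n})$ for some $m,n$; and for all $m,n$ such that $\phi$ satisfies $(D_{m,n})$ one has $h(\phi)=\frac{2n}{n+1}$ (read as $h(\phi)=2$ when $n=\infty$) and $h_{lin}(\phi)=\frac{2m+1}{m+1}$. (2) Conversely, if $\phi$ satisfies $(D_{m,n})$ for some $m,n$, then $\partial_1^{\alpha_1}\partial_2^{\alpha_2}\phi(0,0)=0$ for all $\alpha\in\mathbb{Z}_+^2$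 with $|\alpha|\le2$, $h(\phi)\le2$ and $h_{lin}(\phi)<h(\phi)$. -/

import Mathlib

open Filter Topology
open scoped ContDiff ENNReal

/-- `f` is (real) `C^∞` on some open neighbourhood of `x`. -/
def SmoothNear {E F : Type*} [NormedAddCommGroup E] [NormedSpace ℝ E]
    [NormedAddCommGroup F] [NormedSpace ℝ F] (f : E → F) (x : E) : Prop :=
  ∃ U : Set E, IsOpen U ∧ x ∈ U ∧ ContDiffOn ℝ ∞ f U

/-- The partial derivative `∂₁^i ∂₂^j f (0, 0)`. -/
noncomputable def partialAtZero (i j : ℕ) (f : ℝ × ℝ → ℝ) : ℝ :=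
  iteratedDeriv i (fun s => iteratedDeriv j (fun t => f (s, t)) 0) 0

/-- The Taylor coefficient `c_α = ∂^α f (0, 0) / (α₁! α₂!)`. -/
noncomputable def taylorCoeffAtZero (f : ℝ × ℝ → ℝ) (α : ℕ × ℕ) : ℝ :=
  1 / ((Nat.factorial α.1 : ℝ) * (Nat.factorial α.2 : ℝ)) * partialAtZero α.1 α.2 f

/-- The Taylor support of `f` at the origin. -/
def taylorSupport (f : ℝ × ℝ → ℝ) : Set (ℕ × ℕ) :=
  {α | α ≠ (0, 0) ∧ taylorCoeffAtZero f α ≠ 0}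

/-- The Newton polyhedron: the convex hull of the union of all the octants `α + ℝ₊²`, with `α`
in the Taylor support. -/
def newtonPolyhedron (f : ℝ × ℝ → ℝ) : Set (ℝ × ℝ) :=
  convexHull ℝ (⋃ α ∈ taylorSupport f, {t : ℝ × ℝ | (α.1 : ℝ) ≤ t.1 ∧ (α.2 : ℝ) ≤ t.2})

/-- The Newton distance: the number `d` such that the bisectrix `t₁ = t₂` meets the boundary of the
Newton polyhedron at `(d, d)`. As the polyhedron is stable under adding `ℝ₊²`, this is the least
`d` with `(d, d)` in the polyhedron (see `newtonDist_eq_of_mem_frontier`). It is `∞` when the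
polyhedron is empty, that is, when the Taylor series vanishes. -/
noncomputable def newtonDist (f : ℝ × ℝ → ℝ) : ℝ≥0∞ :=
  ⨅ (d : ℝ) (_ : (d, d) ∈ newtonPolyhedron f), ENNReal.ofReal d

theorem newtonPolyhedron_upward (f : ℝ × ℝ → ℝ) {p q : ℝ × ℝ} (hp : p ∈ newtonPolyhedron f)
    (h1 : p.1 ≤ q.1) (h2 : p.2 ≤ q.2) : q ∈ newtonPolyhedron f := by
  have key : newtonPolyhedron f ⊆ (fun t : ℝ × ℝ => t + (q - p)) ⁻¹' newtonPolyhedron f := by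
    refine convexHull_min ?_ ?_
    · intro t ht
      refine subset_convexHull ℝ _ ?_
      simp only [Set.mem_iUnion, Set.mem_ofPred_eq] at ht ⊢
      obtain ⟨α, hα, ha, hb⟩ := ht
      refine ⟨α, hα, ?_, ?_⟩
      · simp only [Prod.fst_add, Prod.fst_sub]; linarith
      · simp only [Prod.snd_add, Prod.snd_sub]; linarith
    · exact (convex_convexHull ℝ _).translate_preimage_left _
  simpa using key hp

theorem newtonDist_eq_of_mem_frontier (f : ℝ × ℝ → ℝ) {d : ℝ}
    (hd : (d, d) ∈ frontier (newtonPolyhedron f)) : newtonDist f = ENNReal.ofReal d := by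
  apply le_antisymm
  · have hlt : ∀ e : ℝ, d < e → newtonDist f ≤ ENNReal.ofReal e := by
      intro e he
      have hnhds : {p : ℝ × ℝ | p.1 < e ∧ p.2 < e} ∈ 𝓝 (d, d) :=
        ((isOpen_lt continuous_fst continuous_const).inter
          (isOpen_lt continuous_snd continuous_const)).mem_nhds ⟨he, he⟩
      obtain ⟨p, hp, hpN⟩ := mem_closure_iff_nhds.1 hd.1 _ hnhds
      exact iInf₂_le e (newtonPolyhedron_upward f hpN hp.1.le hp.2.le)
    have hcont : Tendsto ENNReal.ofReal (𝓝[>] d) (𝓝 (ENNReal.ofReal d)) :=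
      (ENNReal.continuous_ofReal.tendsto d).mono_left nhdsWithin_le_nhds
    exact ge_of_tendsto hcont (eventually_nhdsWithin_of_forall hlt)
  · refine le_iInf₂ fun e he => ENNReal.ofReal_le_ofReal ?_
    by_contra hlt
    push Not at hlt
    refine hd.2 (mem_interior.2 ⟨{p : ℝ × ℝ | e < p.1 ∧ e < p.2}, ?_, ?_, hlt, hlt⟩)
    · exact fun p hp => newtonPolyhedron_upward f he hp.1.le hp.2.le
    · exact (isOpen_lt continuous_const continuous_fst).inter
        (isOpen_lt continuous_const continuous_snd)

/-- `Ψ` is a smooth local change of coordinates `x = Ψ(y)` at the origin, preserving the origin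
(by the inverse function theorem, invertibility of the differential is what makes `Ψ` a
diffeomorphism between neighbourhoods of the origin). -/
def IsLocalCoordinateChange (Ψ : ℝ × ℝ → ℝ × ℝ) : Prop :=
  SmoothNear Ψ 0 ∧ Ψ 0 = 0 ∧ (fderiv ℝ Ψ 0).IsInvertible

/-- The height `h(f)`: the supremum of the Newton distances over all smooth local coordinate
systems at the origin. -/
noncomputable def height (f : ℝ × ℝ → ℝ) : ℝ≥0∞ :=
  ⨆ (Ψ : ℝ × ℝ → ℝ × ℝ) (_ : IsLocalCoordinateChange Ψ), newtonDist (f ∘ Ψ)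

/-- The linear height `h_lin(f)`: the supremum of the Newton distances over all linear coordinate
systems. -/
noncomputable def linHeight (f : ℝ × ℝ → ℝ) : ℝ≥0∞ :=
  ⨆ L : (ℝ × ℝ) ≃L[ℝ] (ℝ × ℝ), newtonDist (f ∘ L)

/-- Either `n` is finite and `b₀(t) = t^n β(t)` near `0` with `β` smooth, `β(0) ≠ 0`, or `n = ∞`
and `b₀` is flat at `0`. -/
def HasVanishingOrder (b₀ : ℝ → ℝ) (n : ℕ∞) : Prop :=
  (∃ k : ℕ, n = (k : ℕ∞) ∧ ∃ β : ℝ → ℝ, SmoothNear β 0 ∧ β 0 ≠ 0 ∧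
      ∀ᶠ t in 𝓝 (0 : ℝ), b₀ t = t ^ k * β t) ∨
    (n = ⊤ ∧ ∀ k : ℕ, iteratedDeriv k b₀ 0 = 0)

/-- After a linear change of variables, `φ` has the form
`b(x₁, x₂) (x₂ - x₁^m w(x₁))² + b₀(x₁)` near the origin, where `b, w, b₀` are smooth,
`b(0) = 0`, `∂₁b(0) ≠ 0`, `∂₂b(0) = 0`, `m ≥ 2`, `w(0) ≠ 0`, and `b₀` vanishes exactly to the order
`n` with `2m + 1 < n ≤ ∞`. -/
def HasNormalForm (φ : ℝ × ℝ → ℝ) (m : ℕ) (n : ℕ∞) : Prop :=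
  ∃ (L : (ℝ × ℝ) ≃L[ℝ] (ℝ × ℝ)) (b : ℝ × ℝ → ℝ) (w b₀ : ℝ → ℝ),
    SmoothNear b 0 ∧ SmoothNear w 0 ∧ SmoothNear b₀ 0 ∧
    (∀ᶠ x in 𝓝 (0 : ℝ × ℝ), φ (L x) = b x * (x.2 - x.1 ^ m * w x.1) ^ 2 + b₀ x.1) ∧
    b 0 = 0 ∧ partialAtZero 1 0 b ≠ 0 ∧ partialAtZero 0 1 b = 0 ∧
    2 ≤ m ∧ w 0 ≠ 0 ∧
    ((2 * m + 1 : ℕ) : ℕ∞) < n ∧ HasVanishingOrder b₀ n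

/-! A normal form is, in suitable linear coordinates, `b (x₂ - ψ(x₁))² + b₀(x₁)`, where `b` has
linear part a nonzero multiple of `x₁`, `ψ` has order `m` and `b₀` has order `n`. After the shear
`x₂ ↦ x₂ + ψ(x₁)` the decisive terms are `x₁ x₂²` and `x₁^n`, and the line through `(1, 2)` and `(n,
0)` meets the bisectrix at `2n/(n+1)`. Without the shear, `x₁ ψ²` contributes the exponent `2m + 1 <
n`, which gives `(2m+1)/(m+1)` instead.

These values are optimal because in arbitrary coordinates the function is `B U² + b₀(V)`
(`IsDForm`). If the linear part of `U` vanishes on neither axis, the cubic part forces distance at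
most `3/2`. Otherwise the order of `U` along that axis competes with `n`
(`IsDForm.newtonDist_le_of_order_lt`, `IsDForm.newtonDist_le_of_le_order`). A linear change cannot
raise the order of `U` above `m` (`IsStdForm.newtonDist_le_of_axis`).

For existence of the normal form, the vanishing 2-jet gives linear height at least `3/2`, so some
coordinates have distance above `3/2`, which forces a multiple root of the cubic part
(`IsExceptional.exists_multiple_root`). A zero cubic part would give linear height at least `2`. A
cube leads to the types E₆, E₇, E₈, whose height is already attained linearly, or again to linear
height at least `2` (`IsExceptional.false_of_triple`). There remains `x₁ x₂²`: expanding around the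
critical curve `∂₂F = 0` yields the required shape (`ContDiff.exists_isStdForm`), and `n ≤ 2m + 1`
would make the two heights equal.

Taylor coefficients in new coordinates are read off from limits under anisotropic scaling
(`HasLead`), which compose well, rather than from iterated chain rules. -/

/-! ### Integrals depending on a parameter, and Hadamard's lemma -/

section ParametricIntegral

variable {E : Type} [NormedAddCommGroup E] [NormedSpace ℝ E] [FiniteDimensional ℝ E]

theorem hasFDerivAt_intervalIntegral_of_contDiff {G : Type} [NormedAddCommGroup G]
    [NormedSpace ℝ G] [CompleteSpace G] {F : E × ℝ → G} (hF : ContDiff ℝ 1 F) (x₀ : E) :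
    HasFDerivAt (fun x => ∫ t in (0 : ℝ)..1, F (x, t))
      (∫ t in (0 : ℝ)..1, (fderiv ℝ F (x₀, t)).comp (ContinuousLinearMap.inl ℝ E ℝ)) x₀ := by
  have hF' : Continuous fun z : E × ℝ =>
      (fderiv ℝ F z).comp (ContinuousLinearMap.inl ℝ E ℝ) :=
    (hF.continuous_fderiv one_ne_zero).clm_comp continuous_const
  have hK : IsCompact (Metric.closedBall x₀ 1 ×ˢ Set.Icc (0 : ℝ) 1) :=
    (isCompact_closedBall x₀ 1).prod isCompact_Icc
  obtain ⟨C, hC⟩ := hK.exists_bound_of_continuousOn hF'.continuousOn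
  refine intervalIntegral.hasFDerivAt_integral_of_dominated_of_fderiv_le (𝕜 := ℝ)
    (F := fun x t => F (x, t))
    (F' := fun x t => (fderiv ℝ F (x, t)).comp (ContinuousLinearMap.inl ℝ E ℝ))
    (bound := fun _ => C) (Metric.closedBall_mem_nhds x₀ one_pos) ?_ ?_ ?_ ?_ ?_ ?_
  · exact Eventually.of_forall fun x =>
      (hF.continuous.comp (by fun_prop : Continuous fun t : ℝ => (x, t))).aestronglyMeasurable
  · exact (hF.continuous.comp
      (by fun_prop : Continuous fun t : ℝ => (x₀, t))).intervalIntegrable _ _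
  · exact (hF'.comp (by fun_prop : Continuous fun t : ℝ => (x₀, t))).aestronglyMeasurable
  · refine Eventually.of_forall fun t ht x hx => hC (x, t) ⟨hx, ?_⟩
    rw [Set.uIoc_of_le zero_le_one] at ht
    exact ⟨ht.1.le, ht.2⟩
  · exact intervalIntegrable_const
  · refine Eventually.of_forall fun t _ x _ => ?_
    have h1 := (hF.differentiable one_ne_zero (x, t)).hasFDerivAt
    exact h1.comp x (hasFDerivAt_prodMk_left x t)

/-- The derivative is again a parametric integral, with values in `E →L[ℝ] G`; the induction
therefore has to range over the target space. -/
theorem contDiff_intervalIntegral_nat (n : ℕ) {G : Type} [NormedAddCommGroup G]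
    [NormedSpace ℝ G] [CompleteSpace G] {F : E × ℝ → G} (hF : ContDiff ℝ n F) :
    ContDiff ℝ n (fun x => ∫ t in (0 : ℝ)..1, F (x, t)) := by
  induction n generalizing G with
  | zero =>
    rw [Nat.cast_zero, contDiff_zero] at hF ⊢
    exact intervalIntegral.continuous_parametric_intervalIntegral_of_continuous'
      (f := fun x t => F (x, t)) (by simpa [Function.uncurry_def] using hF) 0 1
  | succ n ih =>
    rw [Nat.cast_succ, contDiff_succ_iff_hasFDerivAt]
    refine ⟨_, ?_, fun x => hasFDerivAt_intervalIntegral_of_contDiff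
      (hF.of_le (by exact_mod_cast Nat.le_add_left 1 n)) x⟩
    exact ih (F := fun z => (fderiv ℝ F z).comp (ContinuousLinearMap.inl ℝ E ℝ))
      ((hF.fderiv_right (m := n) (by norm_cast)).clm_comp contDiff_const)

theorem contDiff_intervalIntegral {G : Type} [NormedAddCommGroup G]
    [NormedSpace ℝ G] [CompleteSpace G] {F : E × ℝ → G} (hF : ContDiff ℝ ∞ F) :
    ContDiff ℝ ∞ (fun x => ∫ t in (0 : ℝ)..1, F (x, t)) :=
  contDiff_infty.2 fun n => contDiff_intervalIntegral_nat n (contDiff_infty.1 hF n)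

end ParametricIntegral

/-- Hadamard's lemma in the second variable. -/
theorem exists_eq_add_snd_mul {f : ℝ × ℝ → ℝ} (hf : ContDiff ℝ ∞ f) :
    ∃ g : ℝ × ℝ → ℝ, ContDiff ℝ ∞ g ∧ ∀ x, f x = f (x.1, 0) + x.2 * g x := by
  refine ⟨fun x => ∫ t in (0 : ℝ)..1, fderiv ℝ f (x.1, t * x.2) (0, 1), ?_, fun x => ?_⟩
  · refine contDiff_intervalIntegral (E := ℝ × ℝ)
      (F := fun z : (ℝ × ℝ) × ℝ => fderiv ℝ f (z.1.1, z.2 * z.1.2) (0, 1)) ?_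
    have := hf.fderiv_right (m := ∞) (by simp)
    fun_prop
  · have hd : ∀ t : ℝ, HasDerivAt (fun t : ℝ => f (x.1, t * x.2))
        (x.2 * fderiv ℝ f (x.1, t * x.2) (0, 1)) t := by
      intro t
      have h1 := (hf.differentiable (by simp) (x.1, t * x.2)).hasFDerivAt
      have h2 : HasDerivAt (fun t : ℝ => (x.1, t * x.2)) (0, x.2) t :=
        (hasDerivAt_const t x.1).prodMk (by simpa using (hasDerivAt_id t).mul_const x.2)
      have h3 := h1.comp_hasDerivAt t h2
      have h4 : ((0 : ℝ), x.2) = x.2 • ((0 : ℝ), (1 : ℝ)) := by simp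
      rwa [h4, map_smul, smul_eq_mul] at h3
    have hc : Continuous fun t : ℝ => x.2 * fderiv ℝ f (x.1, t * x.2) (0, 1) := by
      have := (hf.fderiv_right (m := ∞) (by simp)).continuous
      fun_prop
    have := intervalIntegral.integral_eq_sub_of_hasDerivAt (a := 0) (b := 1)
      (fun t _ => hd t) (hc.intervalIntegrable _ _)
    rw [intervalIntegral.integral_const_mul] at this
    simp only [one_mul, zero_mul] at this
    rw [this]; ring

/-- Hadamard's lemma in one variable. -/
theorem exists_eq_add_id_mul {f : ℝ → ℝ} (hf : ContDiff ℝ ∞ f) :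
    ∃ g : ℝ → ℝ, ContDiff ℝ ∞ g ∧ ∀ t, f t = f 0 + t * g t := by
  obtain ⟨g, hg, h⟩ := exists_eq_add_snd_mul (f := fun x => f x.2) (by fun_prop)
  exact ⟨fun t => g (0, t), by fun_prop, fun t => h (0, t)⟩

/-! ### Germs of smooth functions -/

section SmoothNear

variable {E F G : Type*} [NormedAddCommGroup E] [NormedSpace ℝ E]
  [NormedAddCommGroup F] [NormedSpace ℝ F] [NormedAddCommGroup G] [NormedSpace ℝ G]

theorem ContDiff.smoothNear {f : E → F} (hf : ContDiff ℝ ∞ f) (x : E) : SmoothNear f x :=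
  ⟨Set.univ, isOpen_univ, trivial, hf.contDiffOn⟩

theorem SmoothNear.contDiffAt {f : E → F} {x : E} (hf : SmoothNear f x) : ContDiffAt ℝ ∞ f x := by
  obtain ⟨U, hU, hx, h⟩ := hf
  exact h.contDiffAt (hU.mem_nhds hx)

theorem SmoothNear.congr {f g : E → F} {x : E} (hf : SmoothNear f x) (h : g =ᶠ[𝓝 x] f) :
    SmoothNear g x := by
  obtain ⟨U, hU, hx, hfU⟩ := hf
  obtain ⟨V, hV, hVo, hxV⟩ := mem_nhds_iff.1 h
  exact ⟨U ∩ V, hU.inter hVo, ⟨hx, hxV⟩,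
    (hfU.mono Set.inter_subset_left).congr fun y hy => hV hy.2⟩

theorem smoothNear_of_eventually {f : E → F} {x : E} (h : ∀ᶠ y in 𝓝 x, ContDiffAt ℝ ∞ f y) :
    SmoothNear f x := by
  obtain ⟨V, hV, hVo, hxV⟩ := mem_nhds_iff.1 h
  exact ⟨V, hVo, hxV, fun y hy => ContDiffAt.contDiffWithinAt (hV hy)⟩

/-- A germ of smooth function extends to a globally smooth function. -/
theorem SmoothNear.exists_contDiff [FiniteDimensional ℝ E] {f : E → F} {x : E}
    (hf : SmoothNear f x) : ∃ g : E → F, ContDiff ℝ ∞ g ∧ f =ᶠ[𝓝 x] g := by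
  obtain ⟨U, hU, hx, h⟩ := hf
  obtain ⟨r, hr, hrU⟩ := Metric.nhds_basis_closedBall.mem_iff.1 (hU.mem_nhds hx)
  let χ : ContDiffBump x := ⟨r / 2, r, by positivity, by linarith⟩
  refine ⟨fun y => χ y • f y, ?_, ?_⟩
  · rw [contDiff_iff_contDiffAt]
    intro y
    by_cases hy : y ∈ U
    · exact χ.contDiff.contDiffAt.smul (h.contDiffAt (hU.mem_nhds hy))
    · have hy' : y ∈ (tsupport χ)ᶜ := by
        rw [χ.tsupport_eq]
        exact fun hy' => hy (hrU hy')
      have : (fun y => χ y • f y) =ᶠ[𝓝 y] fun _ => 0 := by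
        filter_upwards [(isClosed_tsupport _).isOpen_compl.mem_nhds hy'] with z hz
        rw [image_eq_zero_of_notMem_tsupport hz, zero_smul]
      exact contDiffAt_const.congr_of_eventuallyEq this
  · filter_upwards [χ.eventuallyEq_one] with y hy
    simp [hy]

theorem SmoothNear.comp [FiniteDimensional ℝ E] [FiniteDimensional ℝ F] {f : F → G} {u : E → F}
    {x : E} (hf : SmoothNear f (u x)) (hu : SmoothNear u x) : SmoothNear (fun y => f (u y)) x := by
  obtain ⟨f', hf', hff'⟩ := hf.exists_contDiff
  obtain ⟨u', hu', huu'⟩ := hu.exists_contDiff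
  refine ((hf'.comp hu').smoothNear x).congr ?_
  have h1 := hu.contDiffAt.continuousAt.eventually hff'
  filter_upwards [h1, huu'] with y h1 h2
  rw [h1, h2]; rfl

theorem SmoothNear.prodMk [FiniteDimensional ℝ E] {f : E → F} {g : E → G} {x : E}
    (hf : SmoothNear f x) (hg : SmoothNear g x) : SmoothNear (fun y => (f y, g y)) x := by
  obtain ⟨f', hf', hff'⟩ := hf.exists_contDiff
  obtain ⟨g', hg', hgg'⟩ := hg.exists_contDiff
  refine ((hf'.prodMk hg').smoothNear x).congr ?_
  filter_upwards [hff', hgg'] with y h1 h2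
  rw [h1, h2]

theorem SmoothNear.fst [FiniteDimensional ℝ E] {f : E → F × G} {x : E}
    (hf : SmoothNear f x) : SmoothNear (fun y => (f y).1) x := by
  obtain ⟨f', hf', hff'⟩ := hf.exists_contDiff
  exact (hf'.fst.smoothNear x).congr (hff'.mono fun y h => by simp [h])

theorem SmoothNear.snd [FiniteDimensional ℝ E] {f : E → F × G} {x : E}
    (hf : SmoothNear f x) : SmoothNear (fun y => (f y).2) x := by
  obtain ⟨f', hf', hff'⟩ := hf.exists_contDiff
  exact (hf'.snd.smoothNear x).congr (hff'.mono fun y h => by simp [h])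

theorem SmoothNear.mul [FiniteDimensional ℝ E] {f g : E → ℝ} {x : E}
    (hf : SmoothNear f x) (hg : SmoothNear g x) : SmoothNear (fun y => f y * g y) x :=
  SmoothNear.comp (f := fun z : ℝ × ℝ => z.1 * z.2) (u := fun y => (f y, g y))
    (ContDiff.smoothNear (by fun_prop) _) (hf.prodMk hg)

theorem SmoothNear.add [FiniteDimensional ℝ E] {f g : E → ℝ} {x : E}
    (hf : SmoothNear f x) (hg : SmoothNear g x) : SmoothNear (fun y => f y + g y) x :=
  SmoothNear.comp (f := fun z : ℝ × ℝ => z.1 + z.2) (u := fun y => (f y, g y))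
    (ContDiff.smoothNear (by fun_prop) _) (hf.prodMk hg)

theorem SmoothNear.sub [FiniteDimensional ℝ E] {f g : E → ℝ} {x : E}
    (hf : SmoothNear f x) (hg : SmoothNear g x) : SmoothNear (fun y => f y - g y) x :=
  SmoothNear.comp (f := fun z : ℝ × ℝ => z.1 - z.2) (u := fun y => (f y, g y))
    (ContDiff.smoothNear (by fun_prop) _) (hf.prodMk hg)

theorem SmoothNear.pow [FiniteDimensional ℝ E] {f : E → ℝ} {x : E}
    (hf : SmoothNear f x) (n : ℕ) : SmoothNear (fun y => f y ^ n) x :=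
  SmoothNear.comp (f := fun z : ℝ => z ^ n) (ContDiff.smoothNear (by fun_prop) _) hf

end SmoothNear

/-! ### Taylor coefficients and Taylor's formula -/

theorem iteratedDeriv_succ_id_mul {g : ℝ → ℝ} (hg : ContDiff ℝ ∞ g) (n : ℕ) :
    iteratedDeriv (n + 1) (fun t => t * g t) =
      fun t => t * iteratedDeriv (n + 1) g t + (n + 1) * iteratedDeriv n g t := by
  have hd : ∀ k : ℕ, Differentiable ℝ (iteratedDeriv k g) := fun k =>
    hg.differentiable_iteratedDeriv k (by exact_mod_cast WithTop.coe_lt_top k)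
  induction n with
  | zero =>
    funext t
    have h0 : DifferentiableAt ℝ g t := (hg.differentiable (by simp)) t
    simp only [zero_add, iteratedDeriv_one, iteratedDeriv_zero, Nat.cast_zero]
    have := ((hasDerivAt_id t).mul h0.hasDerivAt).deriv
    simp only [id] at this
    refine Eq.trans ?_ (this.trans ?_)
    · rfl
    · ring
  | succ n ih =>
    funext t
    rw [iteratedDeriv_succ, ih]
    have h1 := (hd (n + 1) t).hasDerivAt
    have h0 := (hd n t).hasDerivAt
    rw [← iteratedDeriv_succ] at h1 h0
    have := (((hasDerivAt_id t).mul h1).add (h0.const_mul ((n : ℝ) + 1))).deriv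
    simp only [id] at this
    refine Eq.trans ?_ (this.trans ?_)
    · rfl
    · push_cast; ring

theorem iteratedDeriv_succ_add_id_mul {g : ℝ → ℝ} (hg : ContDiff ℝ ∞ g) (c : ℝ) (n : ℕ) :
    iteratedDeriv (n + 1) (fun t => c + t * g t) 0 = (n + 1) * iteratedDeriv n g 0 := by
  rw [iteratedDeriv_const_add n.succ_pos, iteratedDeriv_succ_id_mul hg]
  simp

theorem partialAtZero_congr {f g : ℝ × ℝ → ℝ} (h : f =ᶠ[𝓝 0] g) (i j : ℕ) :
    partialAtZero i j f = partialAtZero i j g := by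
  have h' : ∀ᶠ x in 𝓝 ((0 : ℝ), (0 : ℝ)), f x = g x := h
  refine Filter.EventuallyEq.iteratedDeriv_eq i ?_
  filter_upwards [h'.curry_nhds] with s hs
  exact Filter.EventuallyEq.iteratedDeriv_eq j hs

theorem taylorCoeffAtZero_congr {f g : ℝ × ℝ → ℝ} (h : f =ᶠ[𝓝 0] g) (α : ℕ × ℕ) :
    taylorCoeffAtZero f α = taylorCoeffAtZero g α := by
  rw [taylorCoeffAtZero, taylorCoeffAtZero, partialAtZero_congr h]

theorem taylorCoeffAtZero_eq_zero_iff {f : ℝ × ℝ → ℝ} {i j : ℕ} :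
    taylorCoeffAtZero f (i, j) = 0 ↔ partialAtZero i j f = 0 := by
  simp [taylorCoeffAtZero, Nat.factorial_ne_zero]

theorem taylorCoeffAtZero_zero_zero (f : ℝ × ℝ → ℝ) : taylorCoeffAtZero f (0, 0) = f 0 := by
  simp [taylorCoeffAtZero, partialAtZero, Prod.mk_zero_zero]

/-- Multiplication by `x₂` shifts the coefficients, and a function of `x₁` alone contributes nothing
to positive powers of `x₂`. With Hadamard's lemma this drives the inductions below. -/
theorem taylorCoeffAtZero_succ_snd {f g : ℝ × ℝ → ℝ} (hg : ContDiff ℝ ∞ g) {k : ℝ → ℝ}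
    (h : ∀ x, f x = k x.1 + x.2 * g x) (i j : ℕ) :
    taylorCoeffAtZero f (i, j + 1) = taylorCoeffAtZero g (i, j) := by
  have h1 : (fun s => iteratedDeriv (j + 1) (fun t => f (s, t)) 0) =
      fun s => ((j : ℝ) + 1) * iteratedDeriv j (fun t => g (s, t)) 0 := by
    funext s
    simp only [h]
    exact iteratedDeriv_succ_add_id_mul (g := fun t => g (s, t)) (by fun_prop) (k s) j
  simp only [taylorCoeffAtZero, partialAtZero]
  rw [h1, iteratedDeriv_const_mul_field, Nat.factorial_succ]
  have : (Nat.factorial j : ℝ) ≠ 0 := by positivity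
  have : (Nat.factorial i : ℝ) ≠ 0 := by positivity
  have : (j : ℝ) + 1 ≠ 0 := by positivity
  push_cast
  field_simp

theorem taylorCoeffAtZero_fst {f : ℝ × ℝ → ℝ} (i : ℕ) :
    taylorCoeffAtZero f (i, 0) = iteratedDeriv i (fun s => f (s, 0)) 0 / Nat.factorial i := by
  simp [taylorCoeffAtZero, partialAtZero, div_eq_inv_mul]

theorem iteratedDeriv_div_factorial_succ {f g : ℝ → ℝ} (hg : ContDiff ℝ ∞ g) {c : ℝ}
    (h : ∀ t, f t = c + t * g t) (n : ℕ) :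
    iteratedDeriv (n + 1) f 0 / Nat.factorial (n + 1) =
      iteratedDeriv n g 0 / Nat.factorial n := by
  rw [funext h, iteratedDeriv_succ_add_id_mul hg, Nat.factorial_succ]
  have : (Nat.factorial n : ℝ) ≠ 0 := by positivity
  have : (n : ℝ) + 1 ≠ 0 := by positivity
  push_cast
  field_simp

/-- Taylor's formula in one variable. -/
theorem sub_taylor_isBigO {f : ℝ → ℝ} (hf : ContDiff ℝ ∞ f) (N : ℕ) :
    (fun t => f t - ∑ i ∈ Finset.range N, iteratedDeriv i f 0 / Nat.factorial i * t ^ i)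
      =O[𝓝 0] fun t => t ^ N := by
  induction N generalizing f with
  | zero =>
    simpa using (hf.continuous.tendsto 0).isBigO_one ℝ
  | succ N ih =>
    obtain ⟨g, hg, h⟩ := exists_eq_add_id_mul hf
    refine ((Asymptotics.isBigO_refl (fun t : ℝ => t) _).mul (ih hg)).congr (fun t => ?_)
      (fun t => by ring)
    rw [Finset.sum_range_succ', h t, mul_sub, Finset.mul_sum]
    simp only [iteratedDeriv_div_factorial_succ hg h]
    simp only [iteratedDeriv_zero, Nat.factorial_zero, Nat.cast_one, div_one, pow_zero, mul_one]
    rw [add_comm (f 0), add_sub_add_right_eq_sub]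
    congr 1
    exact Finset.sum_congr rfl fun i _ => by ring

/-- Taylor's formula in two variables. -/
theorem sub_taylor₂_isBigO {f : ℝ × ℝ → ℝ} (hf : ContDiff ℝ ∞ f) (N : ℕ) :
    (fun x => f x - ∑ j ∈ Finset.range N, ∑ i ∈ Finset.range (N - j),
      taylorCoeffAtZero f (i, j) * (x.1 ^ i * x.2 ^ j)) =O[𝓝 0] fun x => ‖x‖ ^ N := by
  induction N generalizing f with
  | zero =>
    simpa using (hf.continuous.tendsto 0).isBigO_one ℝ
  | succ N ih =>
    obtain ⟨g, hg, h⟩ := exists_eq_add_snd_mul hf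
    have h1 : (fun x : ℝ × ℝ => x.1) =O[𝓝 0] fun x => ‖x‖ :=
      Asymptotics.IsBigO.of_bound 1 (Eventually.of_forall fun x => by
        simpa using norm_fst_le x)
    have h2 : (fun x : ℝ × ℝ => x.2) =O[𝓝 0] fun x => ‖x‖ :=
      Asymptotics.IsBigO.of_bound 1 (Eventually.of_forall fun x => by
        simpa using norm_snd_le x)
    have h3 := (sub_taylor_isBigO (f := fun s => f (s, 0)) (by fun_prop) (N + 1)).comp_tendsto
      (continuous_fst.tendsto (0 : ℝ × ℝ))
    have h4 := h3.trans (h1.pow (N + 1))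
    refine (h4.add ((h2.mul (ih hg)).congr_right (fun x => (pow_succ' ‖x‖ N).symm))).congr_left
      fun x => ?_
    rw [Finset.sum_range_succ', h x, mul_sub, Finset.mul_sum]
    simp only [taylorCoeffAtZero_succ_snd hg (k := fun s => f (s, 0)) h, taylorCoeffAtZero_fst,
      Nat.succ_sub_succ, Nat.sub_zero, pow_zero, mul_one, Function.comp, Finset.mul_sum]
    have : ∀ j i : ℕ, x.2 * (taylorCoeffAtZero g (i, j) * (x.1 ^ i * x.2 ^ j)) =
        taylorCoeffAtZero g (i, j) * (x.1 ^ i * x.2 ^ (j + 1)) := fun j i => by ring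
    simp only [this]
    ring

/-! ### Leading parts under anisotropic scaling -/

/-- `f` is weighted homogeneous of degree `k` with leading part `P`, up to higher order terms, for
the weights `(p, q)`. -/
def HasLead (f : ℝ × ℝ → ℝ) (p q k : ℕ) (P : ℝ × ℝ → ℝ) : Prop :=
  ∀ x : ℝ × ℝ, Tendsto (fun z : ℝ × (ℝ × ℝ) => f (z.1 ^ p * z.2.1, z.1 ^ q * z.2.2) / z.1 ^ k)
    (𝓝[>] 0 ×ˢ 𝓝 x) (𝓝 (P x))

namespace HasLead

variable {f g : ℝ × ℝ → ℝ} {p q k l : ℕ} {P Q : ℝ × ℝ → ℝ}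

theorem eventually_pos (x : ℝ × ℝ) : ∀ᶠ z : ℝ × (ℝ × ℝ) in 𝓝[>] 0 ×ˢ 𝓝 x, 0 < z.1 :=
  tendsto_fst.eventually (self_mem_nhdsWithin : Set.Ioi (0 : ℝ) ∈ 𝓝[>] 0)

theorem tendsto_eps (x : ℝ × ℝ) :
    Tendsto (fun z : ℝ × (ℝ × ℝ) => z.1) (𝓝[>] 0 ×ˢ 𝓝 x) (𝓝 0) :=
  (tendsto_nhdsWithin_iff.1 (tendsto_fst (f := 𝓝[>] (0 : ℝ)) (g := 𝓝 x))).1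

theorem tendsto_scale (hp : 0 < p) (hq : 0 < q) (x : ℝ × ℝ) :
    Tendsto (fun z : ℝ × (ℝ × ℝ) => (z.1 ^ p * z.2.1, z.1 ^ q * z.2.2)) (𝓝[>] 0 ×ˢ 𝓝 x)
      (𝓝 (0 : ℝ × ℝ)) := by
  have h2 : Tendsto (fun z : ℝ × (ℝ × ℝ) => z.2) (𝓝[>] 0 ×ˢ 𝓝 x) (𝓝 x) := tendsto_snd
  have h3 := (((tendsto_eps x).pow p).mul ((continuous_fst.tendsto x).comp h2)).prodMk_nhds
    (((tendsto_eps x).pow q).mul ((continuous_snd.tendsto x).comp h2))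
  simpa [hp.ne', hq.ne', Prod.mk_zero_zero] using h3

theorem congr (hp : 0 < p) (hq : 0 < q) (h : HasLead f p q k P) (hfg : g =ᶠ[𝓝 0] f) :
    HasLead g p q k P := fun x =>
  (h x).congr' (((tendsto_scale hp hq x).eventually hfg).mono fun z hz => by simp only [hz])

theorem congr_lead (h : HasLead f p q k P) (hPQ : ∀ x, P x = Q x) : HasLead f p q k Q := by
  rwa [← funext hPQ]

theorem add (hf : HasLead f p q k P) (hg : HasLead g p q k Q) :
    HasLead (fun x => f x + g x) p q k (fun x => P x + Q x) := fun x =>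
  ((hf x).add (hg x)).congr fun z => by ring

theorem sub (hf : HasLead f p q k P) (hg : HasLead g p q k Q) :
    HasLead (fun x => f x - g x) p q k (fun x => P x - Q x) := fun x =>
  ((hf x).sub (hg x)).congr fun z => by ring

theorem mul (hf : HasLead f p q k P) (hg : HasLead g p q l Q) :
    HasLead (fun x => f x * g x) p q (k + l) (fun x => P x * Q x) := fun x =>
  ((hf x).mul (hg x)).congr fun z => by rw [pow_add, mul_div_mul_comm]

theorem pow (hf : HasLead f p q k P) (n : ℕ) :
    HasLead (fun x => f x ^ n) p q (n * k) (fun x => P x ^ n) := fun x =>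
  ((hf x).pow n).congr fun z => by simp only [div_pow]; rw [mul_comm n k, pow_mul]

theorem sum {ι : Type*} (s : Finset ι) {F R : ι → ℝ × ℝ → ℝ}
    (h : ∀ i ∈ s, HasLead (F i) p q k (R i)) :
    HasLead (fun x => ∑ i ∈ s, F i x) p q k (fun x => ∑ i ∈ s, R i x) := fun x =>
  (tendsto_finsetSum s fun i hi => h i hi x).congr fun z => by rw [Finset.sum_div]

theorem of_lt (h : HasLead f p q k P) (hlk : l < k) : HasLead f p q l (fun _ => 0) := fun x => by
  have h1 := ((tendsto_eps x).pow (k - l)).mul (h x)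
  rw [zero_pow (by omega), zero_mul] at h1
  refine h1.congr' ((eventually_pos x).mono fun z hz => ?_)
  have : z.1 ^ k = z.1 ^ (k - l) * z.1 ^ l := by rw [← pow_add]; congr 1; omega
  rw [this]
  field_simp

theorem fst (q : ℕ) : HasLead (fun x => x.1) p q p (fun x => x.1) := fun x =>
  ((continuous_fst.tendsto x).comp tendsto_snd).congr'
    ((eventually_pos x).mono fun z hz => by simp [hz.ne'])

theorem snd (p : ℕ) : HasLead (fun x => x.2) p q q (fun x => x.2) := fun x =>
  ((continuous_snd.tendsto x).comp tendsto_snd).congr'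
    ((eventually_pos x).mono fun z hz => by simp [hz.ne'])

theorem const (c : ℝ) : HasLead (fun _ => c) p q 0 (fun _ => c) := fun x => by
  simp

theorem const_mul (c : ℝ) (h : HasLead f p q k P) :
    HasLead (fun x => c * f x) p q k (fun x => c * P x) := by
  simpa using (const c).mul h

theorem of_continuousAt (hp : 0 < p) (hq : 0 < q) (hf : ContinuousAt f 0) :
    HasLead f p q 0 (fun _ => f 0) := fun x => by
  simpa [Function.comp_def] using hf.tendsto.comp (tendsto_scale hp hq x)

/-- The limit defining `HasLead` is joint in the scale and the point, so the rescaled inner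
functions may be inserted as a moving point converging to `(U x, V x)`. -/
theorem comp {p' q' : ℕ} {u v U V : ℝ × ℝ → ℝ} (hf : HasLead f p' q' k P)
    (hu : HasLead u p q p' U) (hv : HasLead v p q q' V) :
    HasLead (fun x => f (u x, v x)) p q k (fun x => P (U x, V x)) := fun x => by
  have h1 : Tendsto (fun z : ℝ × (ℝ × ℝ) => z.1) (𝓝[>] 0 ×ˢ 𝓝 x) (𝓝[>] 0) := tendsto_fst
  refine ((hf (U x, V x)).comp (h1.prodMk ((hu x).prodMk_nhds (hv x)))).congr'
    ((eventually_pos x).mono fun z hz => ?_)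
  have h2 : z.1 ^ p' ≠ 0 := by positivity
  have h3 : z.1 ^ q' ≠ 0 := by positivity
  simp only [Function.comp]
  rw [mul_div_cancel₀ _ h2, mul_div_cancel₀ _ h3]

theorem unique (hf : HasLead f p q k P) (hf' : HasLead f p q k Q) (x : ℝ × ℝ) : P x = Q x :=
  tendsto_nhds_unique (hf x) (hf' x)

theorem monomial (i j : ℕ) :
    HasLead (fun x => x.1 ^ i * x.2 ^ j) p q (p * i + q * j) (fun x => x.1 ^ i * x.2 ^ j) := by
  have := ((fst (p := p) q).pow i).mul ((snd (q := q) p).pow j)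
  rwa [mul_comm i, mul_comm j] at this

/-- For positive weights and scale `ε < 1`, the scaled point has norm at most `ε ‖z.2‖`, so a
remainder of order `N` is `O(ε^N)`. -/
theorem of_isBigO (hp : 0 < p) (hq : 0 < q) {N : ℕ} (hN : k < N)
    (hf : f =O[𝓝 0] fun x => ‖x‖ ^ N) : HasLead f p q k (fun _ => 0) := fun x => by
  have h1 := hf.comp_tendsto (tendsto_scale hp hq x)
  have h2 : (fun z : ℝ × (ℝ × ℝ) => ‖(z.1 ^ p * z.2.1, z.1 ^ q * z.2.2)‖) =O[𝓝[>] 0 ×ˢ 𝓝 x]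
      fun z => z.1 * ‖z.2‖ := by
    refine Asymptotics.IsBigO.of_bound 1 ?_
    have hlt : ∀ᶠ z : ℝ × (ℝ × ℝ) in 𝓝[>] 0 ×ˢ 𝓝 x, z.1 < 1 :=
      (tendsto_eps x).eventually (gt_mem_nhds one_pos)
    filter_upwards [eventually_pos x, hlt] with z hz hz1
    have key : ∀ r : ℕ, 0 < r → ∀ y : ℝ, |y| ≤ ‖z.2‖ → |z.1 ^ r * y| ≤ z.1 * ‖z.2‖ := by
      intro r hr y hy
      rw [abs_mul, abs_of_pos (by positivity)]
      gcongr
      exact pow_le_of_le_one hz.le hz1.le hr.ne'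
    rw [norm_norm, one_mul, Real.norm_of_nonneg (by positivity), Prod.norm_def]
    exact max_le (key p hp _ (norm_fst_le z.2)) (key q hq _ (norm_snd_le z.2))
  have h3 : (fun z : ℝ × (ℝ × ℝ) => ‖z.2‖) =O[𝓝[>] 0 ×ˢ 𝓝 x] fun _ => (1 : ℝ) :=
    ((continuous_norm.tendsto x).comp tendsto_snd).isBigO_one ℝ
  have h4 : (fun z : ℝ × (ℝ × ℝ) => f (z.1 ^ p * z.2.1, z.1 ^ q * z.2.2)) =O[𝓝[>] 0 ×ˢ 𝓝 x]
      fun z => z.1 ^ N := by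
    refine h1.trans ((h2.pow N).trans ?_)
    refine (((Asymptotics.isBigO_refl (fun z : ℝ × (ℝ × ℝ) => z.1) _).mul h3).pow N).congr_right ?_
    simp
  have h5 := h4.mul (Asymptotics.isBigO_refl (fun z : ℝ × (ℝ × ℝ) => (z.1 ^ k)⁻¹) _)
  have h6 : Tendsto (fun z : ℝ × (ℝ × ℝ) => z.1 ^ (N - k)) (𝓝[>] 0 ×ˢ 𝓝 x) (𝓝 0) := by
    simpa [Nat.sub_ne_zero_of_lt hN] using (tendsto_eps x).pow (N - k)
  refine (h5.trans_tendsto (h6.congr' ((eventually_pos x).mono fun z hz => ?_))).congr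
    fun z => (div_eq_mul_inv _ _).symm
  have : z.1 ^ N = z.1 ^ (N - k) * z.1 ^ k := by rw [← pow_add]; congr 1; omega
  simp only [this]
  field_simp

end HasLead

/-- The weighted homogeneous part of degree `k` of the Taylor series of `f`. -/
noncomputable def weightedPart (f : ℝ × ℝ → ℝ) (p q k : ℕ) (x : ℝ × ℝ) : ℝ :=
  ∑ j ∈ Finset.range (k + 1), ∑ i ∈ Finset.range (k + 1 - j),
    if p * i + q * j = k then taylorCoeffAtZero f (i, j) * (x.1 ^ i * x.2 ^ j) else 0

/-- Since both weights are at least `1`, the weighted degree dominates the total degree: the Taylor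
polynomial of total degree `k` contains every monomial of weighted degree `k`, and the remainder is
of higher order. -/
theorem SmoothNear.hasLead_weightedPart {f : ℝ × ℝ → ℝ} (hf : SmoothNear f 0) {p q k : ℕ}
    (hp : 0 < p) (hq : 0 < q)
    (h : ∀ i j, p * i + q * j < k → taylorCoeffAtZero f (i, j) = 0) :
    HasLead f p q k (weightedPart f p q k) := by
  obtain ⟨F, hF, hfF⟩ := hf.exists_contDiff
  have hc := taylorCoeffAtZero_congr hfF
  have h1 := HasLead.of_isBigO hp hq k.lt_succ_self (sub_taylor₂_isBigO hF (k + 1))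
  have h2 : HasLead (fun x => ∑ j ∈ Finset.range (k + 1), ∑ i ∈ Finset.range (k + 1 - j),
      taylorCoeffAtZero F (i, j) * (x.1 ^ i * x.2 ^ j)) p q k (weightedPart f p q k) := by
    refine HasLead.sum _ fun j _ => HasLead.sum _ fun i _ => ?_
    rw [← hc]
    rcases lt_trichotomy (p * i + q * j) k with hlt | heq | hgt
    · rw [h i j hlt]
      simpa using HasLead.of_isBigO (f := fun _ => (0 : ℝ)) hp hq k.lt_succ_self
        (Asymptotics.isBigO_zero _ _)
    · simp only [heq, if_true]
      rw [← heq]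
      exact (HasLead.monomial i j).const_mul _
    · simp only [hgt.ne', if_false]
      exact ((HasLead.monomial i j).const_mul _).of_lt hgt
  refine ((h1.add h2).congr hp hq (hfF.mono fun x hx => ?_)).congr_lead fun x => zero_add _
  rw [hx]; ring

theorem weightedPart_apply_one {f : ℝ × ℝ → ℝ} {p q k : ℕ} (t : ℝ) :
    weightedPart f p q k (t, 1) = (∑ j ∈ Finset.range (k + 1), ∑ i ∈ Finset.range (k + 1 - j),
      if p * i + q * j = k then Polynomial.C (taylorCoeffAtZero f (i, j)) * Polynomial.X ^ i
        else 0).eval t := by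
  simp only [weightedPart, Polynomial.eval_finsetSum]
  refine Finset.sum_congr rfl fun j _ => Finset.sum_congr rfl fun i _ => ?_
  split_ifs <;> simp

/-- Setting `x₂ = 1` loses nothing: on the line `p i + q j = k` the exponent `i` determines `j`, so
distinct monomials stay distinct powers of `t`. -/
theorem taylorCoeffAtZero_eq_coeff_of_weightedPart {f : ℝ × ℝ → ℝ} {p q k : ℕ} (hp : 0 < p)
    (hq : 0 < q) {Q : Polynomial ℝ} (h : ∀ t, weightedPart f p q k (t, 1) = Q.eval t)
    {i j : ℕ} (hij : p * i + q * j = k) : taylorCoeffAtZero f (i, j) = Q.coeff i := by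
  have hQ := Polynomial.funext fun t => (h t).symm.trans (weightedPart_apply_one t)
  have hi : i ≤ p * i := Nat.le_mul_of_pos_left _ hp
  have hj : j ≤ q * j := Nat.le_mul_of_pos_left _ hq
  rw [hQ, Polynomial.finsetSum_coeff, Finset.sum_eq_single_of_mem j (by simp; omega),
    Polynomial.finsetSum_coeff, Finset.sum_eq_single_of_mem i (by simp; omega)]
  · simp [hij]
  · intro i' _ hi'
    split_ifs
    · simp [Polynomial.coeff_X_pow, hi'.symm]
    · simp
  · intro j' _ hj'
    rw [Polynomial.finsetSum_coeff]
    refine Finset.sum_eq_zero fun i' _ => ?_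
    split_ifs with h'
    · have : i' ≠ i := by
        rintro rfl
        exact hj' (Nat.eq_of_mul_eq_mul_left hq (by omega))
      simp [Polynomial.coeff_X_pow, this.symm]
    · simp

/-- Strong induction on the weighted degree: once the lower coefficients vanish, the weighted part
of degree `l < k` is a leading part, and so is `0`; leading parts are unique. -/
theorem HasLead.taylorCoeffAtZero_eq_zero {f : ℝ × ℝ → ℝ} (hf : SmoothNear f 0) {p q k : ℕ}
    (hp : 0 < p) (hq : 0 < q) {P : ℝ × ℝ → ℝ} (h : HasLead f p q k P) (i j : ℕ)
    (hij : p * i + q * j < k) : taylorCoeffAtZero f (i, j) = 0 := by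
  have key : ∀ l i j, p * i + q * j = l → l < k → taylorCoeffAtZero f (i, j) = 0 := by
    intro l
    induction l using Nat.strong_induction_on with
    | _ l ih =>
      intro i j hij hl
      have h1 := hf.hasLead_weightedPart hp hq (k := l) fun i' j' h' =>
        ih _ h' i' j' rfl (h'.trans hl)
      have h2 := taylorCoeffAtZero_eq_coeff_of_weightedPart (f := f) hp hq (Q := 0)
        (fun t => by simpa using h1.unique (h.of_lt hl) (t, 1)) hij
      simpa using h2
  exact key _ i j rfl hij

theorem HasLead.taylorCoeffAtZero_eq {f : ℝ × ℝ → ℝ} (hf : SmoothNear f 0) {p q k : ℕ}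
    (hp : 0 < p) (hq : 0 < q) {P : ℝ × ℝ → ℝ} (h : HasLead f p q k P) (Q : Polynomial ℝ)
    (hQ : ∀ t, P (t, 1) = Q.eval t) {i j : ℕ}
    (hij : p * i + q * j = k) : taylorCoeffAtZero f (i, j) = Q.coeff i := by
  have h1 := hf.hasLead_weightedPart hp hq (k := k) fun i' j' h' =>
    h.taylorCoeffAtZero_eq_zero hf hp hq i' j' h'
  exact taylorCoeffAtZero_eq_coeff_of_weightedPart hp hq
    (fun t => (h1.unique h (t, 1)).trans (hQ t)) hij

/-! ### Exchanging the two variables -/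

theorem contDiff_iteratedDeriv_snd {g : ℝ × ℝ → ℝ} (hg : ContDiff ℝ ∞ g) (j : ℕ) :
    ContDiff ℝ ∞ fun s : ℝ => iteratedDeriv j (fun t => g (s, t)) 0 := by
  induction j generalizing g with
  | zero => simpa using (by fun_prop : ContDiff ℝ ∞ fun s : ℝ => g (s, 0))
  | succ j ih =>
    have h1 : ContDiff ℝ ∞ fun x : ℝ × ℝ => fderiv ℝ g x (0, 1) := by
      have := hg.fderiv_right (m := ∞) (by simp)
      fun_prop
    convert ih h1 using 2 with s
    rw [iteratedDeriv_succ']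
    congr 1
    funext t
    exact ((hg.differentiable (by simp) (s, t)).hasFDerivAt.comp_hasDerivAt t
      ((hasDerivAt_const t s).prodMk (hasDerivAt_id t))).deriv

theorem taylorCoeffAtZero_succ_fst {f g : ℝ × ℝ → ℝ} (hg : ContDiff ℝ ∞ g) {k : ℝ → ℝ}
    (hk : ContDiff ℝ ∞ k) (h : ∀ x, f x = k x.2 + x.1 * g x) (i j : ℕ) :
    taylorCoeffAtZero f (i + 1, j) = taylorCoeffAtZero g (i, j) := by
  have h1 : (fun s => iteratedDeriv j (fun t => f (s, t)) 0) =
      fun s => iteratedDeriv j k 0 + s * iteratedDeriv j (fun t => g (s, t)) 0 := by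
    funext s
    have h2 : ContDiff ℝ j fun t => g (s, t) :=
      (hg.comp (contDiff_prodMk_right s)).of_le (by exact_mod_cast le_top)
    have h3 : ContDiff ℝ j k := hk.of_le (by exact_mod_cast le_top)
    simp only [h]
    rw [← iteratedDeriv_const_mul_field]
    exact iteratedDeriv_fun_add h3.contDiffAt (contDiff_const.mul h2).contDiffAt
  simp only [taylorCoeffAtZero, partialAtZero]
  rw [h1, iteratedDeriv_succ_add_id_mul (contDiff_iteratedDeriv_snd hg j), Nat.factorial_succ]
  have : (Nat.factorial j : ℝ) ≠ 0 := by positivity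
  have : (Nat.factorial i : ℝ) ≠ 0 := by positivity
  have : (i : ℝ) + 1 ≠ 0 := by positivity
  push_cast
  field_simp

/-- Hadamard's lemma lowers one exponent at a time on both sides, which replaces an appeal to the
symmetry of mixed partial derivatives. -/
theorem ContDiff.taylorCoeffAtZero_swap {f : ℝ × ℝ → ℝ} (hf : ContDiff ℝ ∞ f) (i j : ℕ) :
    taylorCoeffAtZero (fun x => f x.swap) (i, j) = taylorCoeffAtZero f (j, i) := by
  induction i generalizing f with
  | zero => simp [taylorCoeffAtZero, partialAtZero]
  | succ i ih =>
    obtain ⟨g, hg, h⟩ := exists_eq_add_snd_mul hf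
    have hgs : ContDiff ℝ ∞ fun x : ℝ × ℝ => g x.swap := by
      simp only [Prod.swap]; fun_prop
    rw [taylorCoeffAtZero_succ_snd hg (k := fun s => f (s, 0)) h, ← ih hg]
    exact taylorCoeffAtZero_succ_fst hgs (k := fun s => f (s, 0)) (by fun_prop)
      (fun x => h x.swap) i j

theorem smoothNear_swap : SmoothNear (Prod.swap : ℝ × ℝ → ℝ × ℝ) 0 :=
  (contDiff_snd.prodMk contDiff_fst).smoothNear 0

theorem SmoothNear.comp_swap {f : ℝ × ℝ → ℝ} (hf : SmoothNear f 0) :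
    SmoothNear (fun x : ℝ × ℝ => f x.swap) 0 :=
  SmoothNear.comp (f := f) (x := (0 : ℝ × ℝ)) (u := Prod.swap) hf smoothNear_swap

theorem SmoothNear.taylorCoeffAtZero_swap {f : ℝ × ℝ → ℝ} (hf : SmoothNear f 0) (i j : ℕ) :
    taylorCoeffAtZero (fun x => f x.swap) (i, j) = taylorCoeffAtZero f (j, i) := by
  obtain ⟨F, hF, hfF⟩ := hf.exists_contDiff
  have h : (fun x : ℝ × ℝ => f x.swap) =ᶠ[𝓝 0] fun x => F x.swap :=
    (continuous_swap.tendsto (0 : ℝ × ℝ)).eventually hfF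
  rw [taylorCoeffAtZero_congr h, taylorCoeffAtZero_congr hfF, hF.taylorCoeffAtZero_swap]

/-! ### Bounding the Newton distance -/

theorem newtonDist_le {f : ℝ × ℝ → ℝ} {i j k l : ℕ} (h1 : taylorCoeffAtZero f (i, j) ≠ 0)
    (h2 : taylorCoeffAtZero f (k, l) ≠ 0) (h1' : 0 < i + j) (h2' : 0 < k + l) {θ D : ℝ}
    (hθ : 0 ≤ θ) (hθ' : θ ≤ 1) (hx : θ * i + (1 - θ) * k ≤ D) (hy : θ * j + (1 - θ) * l ≤ D) :
    newtonDist f ≤ ENNReal.ofReal D := by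
  refine iInf₂_le D ?_
  have hmem : ∀ a b : ℕ, taylorCoeffAtZero f (a, b) ≠ 0 → 0 < a + b →
      ((a : ℝ), (b : ℝ)) ∈ newtonPolyhedron f := by
    intro a b hab h0
    refine subset_convexHull ℝ _ (Set.mem_iUnion₂.2 ⟨(a, b), ⟨?_, hab⟩, le_rfl, le_rfl⟩)
    rintro h
    simp only [Prod.mk.injEq] at h
    omega
  have h3 := convex_convexHull ℝ _ (hmem i j h1 h1') (hmem k l h2 h2') hθ (sub_nonneg.2 hθ')
    (by ring)
  exact newtonPolyhedron_upward f h3 (by simpa using hx) (by simpa using hy)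

/-- The half-plane `p t₁ + q t₂ ≥ l` is convex and contains every octant of the polyhedron; it meets
the bisectrix at `l / (p + q)`. -/
theorem le_newtonDist {f : ℝ × ℝ → ℝ} {p q l : ℕ} (hpq : 0 < p + q)
    (h : ∀ i j, 0 < i + j → p * i + q * j < l → taylorCoeffAtZero f (i, j) = 0) :
    ENNReal.ofReal ((l : ℝ) / (p + q)) ≤ newtonDist f := by
  have hpq' : (0 : ℝ) < p + q := by exact_mod_cast hpq
  refine le_iInf₂ fun d hd => ENNReal.ofReal_le_ofReal ?_
  have key : newtonPolyhedron f ⊆ {t : ℝ × ℝ | (l : ℝ) ≤ p * t.1 + q * t.2} := by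
    refine convexHull_min ?_ ?_
    · intro t ht
      simp only [Set.mem_iUnion, Set.mem_ofPred_eq] at ht ⊢
      obtain ⟨α, ⟨h0, hα⟩, ha, hb⟩ := ht
      have hl : l ≤ p * α.1 + q * α.2 := by
        by_contra hlt
        refine hα (h α.1 α.2 ?_ (not_le.1 hlt))
        by_contra h0'
        exact h0 (Prod.ext (by simp; omega) (by simp; omega))
      have hl' : (l : ℝ) ≤ p * α.1 + q * α.2 := by exact_mod_cast hl
      have h3 := mul_le_mul_of_nonneg_left ha (Nat.cast_nonneg (α := ℝ) p)
      have h4 := mul_le_mul_of_nonneg_left hb (Nat.cast_nonneg (α := ℝ) q)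
      linarith
    · refine convex_halfSpace_ge (f := fun t : ℝ × ℝ => (p : ℝ) * t.1 + q * t.2) ?_ _
      constructor
      · intro x y; simp; ring
      · intro c x; simp; ring
  have := key hd
  simp only [Set.mem_ofPred_eq] at this
  rw [div_le_iff₀ hpq']
  linarith

theorem newtonPolyhedron_swap_subset {f g : ℝ × ℝ → ℝ}
    (h : ∀ i j, taylorCoeffAtZero g (i, j) = taylorCoeffAtZero f (j, i)) :
    newtonPolyhedron f ⊆ (LinearEquiv.prodComm ℝ ℝ ℝ) ⁻¹' newtonPolyhedron g := by
  refine convexHull_min ?_ ((convex_convexHull ℝ _).linear_preimage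
    (LinearEquiv.prodComm ℝ ℝ ℝ).toLinearMap)
  intro t ht
  refine subset_convexHull ℝ _ ?_
  simp only [Set.mem_iUnion, Set.mem_ofPred_eq] at ht ⊢
  obtain ⟨α, ⟨h0, hα⟩, ha, hb⟩ := ht
  refine ⟨α.swap, ⟨fun h' => h0 ?_, ?_⟩, hb, ha⟩
  · rw [← Prod.swap_swap α, h']; rfl
  · rw [show α.swap = (α.2, α.1) from rfl, h]
    exact hα

theorem SmoothNear.newtonDist_swap {f : ℝ × ℝ → ℝ} (hf : SmoothNear f 0) :
    newtonDist (fun x => f x.swap) = newtonDist f := by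
  have h1 := newtonPolyhedron_swap_subset (f := f) (g := fun x => f x.swap)
    hf.taylorCoeffAtZero_swap
  have h2 := newtonPolyhedron_swap_subset (f := fun x => f x.swap) (g := f)
    fun i j => (hf.taylorCoeffAtZero_swap j i).symm
  exact le_antisymm (le_iInf₂ fun d hd => iInf₂_le d (h1 hd))
    (le_iInf₂ fun d hd => iInf₂_le d (h2 hd))

/-! ### Factorization along an axis and resulting leading parts -/

theorem ContDiff.exists_eq_pow_mul {f : ℝ → ℝ} (hf : ContDiff ℝ ∞ f) {N : ℕ}
    (h : ∀ i < N, iteratedDeriv i f 0 = 0) :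
    ∃ g : ℝ → ℝ, ContDiff ℝ ∞ g ∧ (∀ t, f t = t ^ N * g t) ∧
      g 0 = iteratedDeriv N f 0 / Nat.factorial N := by
  induction N generalizing f with
  | zero => exact ⟨f, hf, by simp, by simp⟩
  | succ N ih =>
    obtain ⟨k, hk, hfk⟩ := exists_eq_add_id_mul hf
    have h0 : f 0 = 0 := by simpa using h 0 N.succ_pos
    have hder := iteratedDeriv_div_factorial_succ hk hfk
    obtain ⟨g, hg, hkg, hg0⟩ := ih hk fun i hi => by
      have := hder i
      rw [h (i + 1) (by omega), zero_div] at this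
      have hi' : (Nat.factorial i : ℝ) ≠ 0 := by positivity
      exact (div_eq_zero_iff.1 this.symm).resolve_right hi'
    refine ⟨g, hg, fun t => ?_, by rw [hg0, hder]⟩
    rw [hfk, h0, hkg]
    ring

theorem SmoothNear.exists_axis_form {f : ℝ × ℝ → ℝ} (hf : SmoothNear f 0) {N : ℕ}
    (h : ∀ i < N, taylorCoeffAtZero f (i, 0) = 0) :
    ∃ (k : ℝ → ℝ) (g : ℝ × ℝ → ℝ), ContDiff ℝ ∞ k ∧ ContDiff ℝ ∞ g ∧
      f =ᶠ[𝓝 0] (fun x => x.1 ^ N * k x.1 + x.2 * g x) ∧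
      k 0 = taylorCoeffAtZero f (N, 0) ∧ g 0 = taylorCoeffAtZero f (0, 1) := by
  obtain ⟨F, hF, hfF⟩ := hf.exists_contDiff
  obtain ⟨g, hg, hFg⟩ := exists_eq_add_snd_mul hF
  have hc := taylorCoeffAtZero_congr hfF
  obtain ⟨k, hk, hFk, hk0⟩ := ContDiff.exists_eq_pow_mul (f := fun s => F (s, 0)) (by fun_prop)
    (N := N) fun i hi => by
      have := h i hi
      rw [hc, taylorCoeffAtZero_fst] at this
      have hi' : (Nat.factorial i : ℝ) ≠ 0 := by positivity
      exact (div_eq_zero_iff.1 this).resolve_right hi'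
  refine ⟨k, g, hk, hg, hfF.trans (Eventually.of_forall fun x => ?_), ?_, ?_⟩
  · rw [hFg, hFk]
  · rw [hk0, hc, taylorCoeffAtZero_fst]
  · rw [hc, taylorCoeffAtZero_succ_snd hg (k := fun s => F (s, 0)) hFg,
      taylorCoeffAtZero_zero_zero]

theorem SmoothNear.hasLead_linear {f : ℝ × ℝ → ℝ} (hf : SmoothNear f 0) (h0 : f 0 = 0) :
    HasLead f 1 1 1 (fun x => taylorCoeffAtZero f (1, 0) * x.1 +
      taylorCoeffAtZero f (0, 1) * x.2) := by
  refine (hf.hasLead_weightedPart one_pos one_pos fun i j hij => ?_).congr_lead fun x => ?_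
  · obtain ⟨rfl, rfl⟩ : i = 0 ∧ j = 0 := by omega
    rw [taylorCoeffAtZero_zero_zero, h0]
  · simp [weightedPart, Finset.sum_range_succ]

/-- Since `p < q`, everything divisible by `x₂` has weighted degree above `p`, so only the `x₁` term
survives. -/
theorem SmoothNear.hasLead_fst {f : ℝ × ℝ → ℝ} (hf : SmoothNear f 0) (h0 : f 0 = 0) {p q : ℕ}
    (hp : 0 < p) (hpq : p < q) :
    HasLead f p q p (fun x => taylorCoeffAtZero f (1, 0) * x.1) := by
  obtain ⟨k, g, hk, hg, hfe, hk0, -⟩ := hf.exists_axis_form (N := 1) fun i hi => by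
    obtain rfl : i = 0 := by omega
    rw [taylorCoeffAtZero_zero_zero, h0]
  have hq : 0 < q := hp.trans hpq
  have h1 : HasLead (fun x => k x.1) p q 0 (fun _ => k 0) :=
    HasLead.of_continuousAt hp hq (hk.continuous.comp continuous_fst).continuousAt
  have h2 : HasLead (fun x => x.2 * g x) p q p (fun _ => 0) :=
    ((HasLead.snd p).mul (HasLead.of_continuousAt hp hq hg.continuous.continuousAt)).of_lt hpq
  refine ((((HasLead.fst q).mul h1).add h2).congr hp hq ?_).congr_lead fun x => ?_
  · simpa using hfe
  · rw [hk0]; ring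

/-- The leading part, for weights `(p, q)` with `q ≤ p * N`, of a function whose restriction to the
first axis vanishes to order at least `N`. -/
theorem SmoothNear.hasLead_axis {f : ℝ × ℝ → ℝ} (hf : SmoothNear f 0) {N : ℕ}
    (h : ∀ i < N, taylorCoeffAtZero f (i, 0) = 0) {p q : ℕ} (hp : 0 < p) (hq : 0 < q)
    (hN : q ≤ p * N) :
    HasLead f p q q (fun x => taylorCoeffAtZero f (0, 1) * x.2 +
      (if q = p * N then taylorCoeffAtZero f (N, 0) else 0) * x.1 ^ N) := by
  obtain ⟨k, g, hk, hg, hfe, hk0, hg0⟩ := hf.exists_axis_form h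
  have h1 : HasLead (fun x => x.1 ^ N * k x.1) p q (N * p + 0) (fun x => x.1 ^ N * k 0) :=
    ((HasLead.fst q).pow N).mul
      (HasLead.of_continuousAt (f := fun x => k x.1) hp hq
        (hk.continuous.comp continuous_fst).continuousAt)
  have h2 : HasLead (fun x => x.2 * g x) p q q (fun x => x.2 * g 0) :=
    (HasLead.snd p).mul (HasLead.of_continuousAt hp hq hg.continuous.continuousAt)
  have h3 : HasLead (fun x => x.1 ^ N * k x.1) p q q
      (fun x => (if q = p * N then k 0 else 0) * x.1 ^ N) := by
    split_ifs with hqN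
    · rw [add_zero, mul_comm N p, ← hqN] at h1
      exact h1.congr_lead fun x => mul_comm _ _
    · exact (h1.of_lt (by rw [add_zero, mul_comm N p]; omega)).congr_lead fun x => by ring
  refine ((h3.add h2).congr hp hq hfe).congr_lead fun x => ?_
  rw [hk0, hg0]; ring

theorem HasLead.comp_pow_mul {v P : ℝ × ℝ → ℝ} {p q l N : ℕ} {b β : ℝ → ℝ} (hp : 0 < p)
    (hq : 0 < q) (hv : HasLead v p q l P) (hv0 : ContinuousAt v 0) (hv00 : v 0 = 0)
    (hβ : ContinuousAt β 0) (hb : ∀ᶠ t in 𝓝 (0 : ℝ), b t = t ^ N * β t) :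
    HasLead (fun x => b (v x)) p q (N * l) (fun x => P x ^ N * β 0) := by
  have h1 : ContinuousAt (fun x => β (v x)) 0 :=
    ContinuousAt.comp (g := β) (f := v) (by rwa [hv00]) hv0
  have h2 := (hv.pow N).mul (HasLead.of_continuousAt hp hq h1)
  rw [hv00] at h2
  refine h2.congr hp hq ?_
  have h3 : Tendsto v (𝓝 0) (𝓝 0) := by simpa [hv00] using hv0.tendsto
  exact h3.eventually hb

/-- The two points lie on `t₁ + t₂ = 3`, on opposite sides of the bisectrix, so their segment
contains `(3/2, 3/2)`. -/
theorem newtonDist_le_three_halves {g : ℝ × ℝ → ℝ}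
    (h1 : taylorCoeffAtZero g (3, 0) ≠ 0 ∨ taylorCoeffAtZero g (2, 1) ≠ 0)
    (h2 : taylorCoeffAtZero g (0, 3) ≠ 0 ∨ taylorCoeffAtZero g (1, 2) ≠ 0) :
    newtonDist g ≤ ENNReal.ofReal (3 / 2) := by
  rcases h1 with h1 | h1 <;> rcases h2 with h2 | h2
  · exact newtonDist_le h1 h2 (by norm_num) (by norm_num) (θ := 1 / 2) (by norm_num)
      (by norm_num) (by norm_num) (by norm_num)
  · exact newtonDist_le h1 h2 (by norm_num) (by norm_num) (θ := 1 / 4) (by norm_num)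
      (by norm_num) (by norm_num) (by norm_num)
  · exact newtonDist_le h1 h2 (by norm_num) (by norm_num) (θ := 3 / 4) (by norm_num)
      (by norm_num) (by norm_num) (by norm_num)
  · exact newtonDist_le h1 h2 (by norm_num) (by norm_num) (θ := 1 / 2) (by norm_num)
      (by norm_num) (by norm_num) (by norm_num)

theorem newtonDist_le_of_edge {g : ℝ × ℝ → ℝ} {n : ℕ} (hn : 0 < n)
    (h1 : taylorCoeffAtZero g (1, 2) ≠ 0) (h2 : taylorCoeffAtZero g (n, 0) ≠ 0) :
    newtonDist g ≤ ENNReal.ofReal (2 * n / (n + 1)) := by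
  have h0 : (0 : ℝ) < n + 1 := by positivity
  refine newtonDist_le h1 h2 (by norm_num) (by omega) (θ := n / (n + 1)) (by positivity) ?_ ?_ ?_
  · rw [div_le_one h0]; linarith
  · apply le_of_eq; field_simp; push_cast; ring
  · apply le_of_eq; field_simp; push_cast; ring

/-- For `n = 2j + 1` the point `(j + 1, 1)` is the midpoint of the segment from `(1, 2)` to `(n,
0)`, and the bisectrix crosses that segment between heights `1` and `2`. It can thus replace `(n,
0)`. -/
theorem newtonDist_le_of_edge_odd {g : ℝ × ℝ → ℝ} {j : ℕ}
    (h1 : taylorCoeffAtZero g (1, 2) ≠ 0) (h2 : taylorCoeffAtZero g (j + 1, 1) ≠ 0) :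
    newtonDist g ≤ ENNReal.ofReal (2 * (2 * j + 1 : ℕ) / ((2 * j + 1 : ℕ) + 1)) := by
  have h0 : (0 : ℝ) < j + 1 := by positivity
  have h0' : (2 * j + 1 + 1 : ℝ) ≠ 0 := by positivity
  refine newtonDist_le h1 h2 (by norm_num) (by omega) (θ := j / (j + 1)) (by positivity) ?_ ?_ ?_
  · rw [div_le_one h0]; linarith
  · apply le_of_eq; push_cast; field_simp; ring
  · apply le_of_eq; push_cast; field_simp; ring

theorem two_mul_div_le {k n : ℕ} (hkn : k ≤ n) :
    ENNReal.ofReal (2 * k / (k + 1)) ≤ ENNReal.ofReal (2 * n / (n + 1)) := by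
  refine ENNReal.ofReal_le_ofReal ?_
  have : (k : ℝ) ≤ n := by exact_mod_cast hkn
  rw [div_le_div_iff₀ (by positivity) (by positivity)]
  nlinarith

/-! ### Newton distance of `B U² + b₀(V)` in arbitrary coordinates -/

/-- `g = B U² + b₀(V)` near the origin, where `(U, V)` are local coordinates and the linear part of
`B` is a nonzero multiple of that of `V`. -/
structure IsDForm (g B U V : ℝ × ℝ → ℝ) (b₀ : ℝ → ℝ) : Prop where
  eq : g =ᶠ[𝓝 0] fun x => B x * U x ^ 2 + b₀ (V x)
  smoothB : SmoothNear B 0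
  smoothU : SmoothNear U 0
  smoothV : SmoothNear V 0
  smooth₀ : SmoothNear b₀ 0
  B0 : B 0 = 0
  U0 : U 0 = 0
  V0 : V 0 = 0
  linB : ∃ a : ℝ, a ≠ 0 ∧ taylorCoeffAtZero B (1, 0) = a * taylorCoeffAtZero V (1, 0) ∧
    taylorCoeffAtZero B (0, 1) = a * taylorCoeffAtZero V (0, 1)
  det : taylorCoeffAtZero V (1, 0) * taylorCoeffAtZero U (0, 1) -
    taylorCoeffAtZero V (0, 1) * taylorCoeffAtZero U (1, 0) ≠ 0

namespace IsDForm

variable {g B U V : ℝ × ℝ → ℝ} {b₀ : ℝ → ℝ}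

theorem smooth (h : IsDForm g B U V b₀) : SmoothNear g 0 := by
  refine ((h.smoothB.mul (h.smoothU.pow 2)).add (SmoothNear.comp (f := b₀) ?_ h.smoothV)).congr h.eq
  rw [h.V0]
  exact h.smooth₀

theorem swap (h : IsDForm g B U V b₀) :
    IsDForm (fun x => g x.swap) (fun x => B x.swap) (fun x => U x.swap) (fun x => V x.swap) b₀ where
  eq := (continuous_swap.tendsto (0 : ℝ × ℝ)).eventually h.eq
  smoothB := h.smoothB.comp_swap
  smoothU := h.smoothU.comp_swap
  smoothV := h.smoothV.comp_swap
  smooth₀ := h.smooth₀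
  B0 := h.B0
  U0 := h.U0
  V0 := h.V0
  linB := by
    obtain ⟨a, ha, h1, h2⟩ := h.linB
    refine ⟨a, ha, ?_, ?_⟩
    · rw [h.smoothB.taylorCoeffAtZero_swap, h.smoothV.taylorCoeffAtZero_swap, h2]
    · rw [h.smoothB.taylorCoeffAtZero_swap, h.smoothV.taylorCoeffAtZero_swap, h1]
  det := by
    rw [h.smoothU.taylorCoeffAtZero_swap, h.smoothV.taylorCoeffAtZero_swap,
      h.smoothU.taylorCoeffAtZero_swap, h.smoothV.taylorCoeffAtZero_swap]
    intro h'
    exact h.det (by linarith)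

theorem hasLead_comp {β : ℝ → ℝ} {N p q l : ℕ} {P : ℝ × ℝ → ℝ} (h : IsDForm g B U V b₀)
    (hp : 0 < p) (hq : 0 < q) (hV : HasLead V p q l P) (hβ : ContinuousAt β 0)
    (hb : ∀ᶠ t in 𝓝 (0 : ℝ), b₀ t = t ^ N * β t) :
    HasLead (fun x => b₀ (V x)) p q (N * l) (fun x => P x ^ N * β 0) :=
  hV.comp_pow_mul hp hq h.smoothV.contDiffAt.continuousAt h.V0 hβ hb

theorem hasLead_cubic {β : ℝ → ℝ} (h : IsDForm g B U V b₀) (hβ : ContinuousAt β 0)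
    (hb : ∀ᶠ t in 𝓝 (0 : ℝ), b₀ t = t ^ 4 * β t) :
    HasLead g 1 1 3 (fun x => (taylorCoeffAtZero B (1, 0) * x.1 + taylorCoeffAtZero B (0, 1) * x.2)
      * (taylorCoeffAtZero U (1, 0) * x.1 + taylorCoeffAtZero U (0, 1) * x.2) ^ 2) := by
  have h1 := (h.smoothB.hasLead_linear h.B0).mul ((h.smoothU.hasLead_linear h.U0).pow 2)
  have h2 := (h.hasLead_comp one_pos one_pos (h.smoothV.hasLead_linear h.V0) hβ hb).of_lt
    (l := 3) (by norm_num)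
  exact ((h1.add h2).congr one_pos one_pos h.eq).congr_lead fun x => add_zero _

theorem coeff_cubic {β : ℝ → ℝ} (h : IsDForm g B U V b₀) (hβ : ContinuousAt β 0)
    (hb : ∀ᶠ t in 𝓝 (0 : ℝ), b₀ t = t ^ 4 * β t) {B1 B2 r s : ℝ}
    (hB1 : taylorCoeffAtZero B (1, 0) = B1) (hB2 : taylorCoeffAtZero B (0, 1) = B2)
    (hr : taylorCoeffAtZero U (1, 0) = r) (hs : taylorCoeffAtZero U (0, 1) = s) :
    taylorCoeffAtZero g (3, 0) = B1 * r ^ 2 ∧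
    taylorCoeffAtZero g (2, 1) = 2 * B1 * r * s + B2 * r ^ 2 ∧
    taylorCoeffAtZero g (1, 2) = B1 * s ^ 2 + 2 * B2 * r * s ∧
    taylorCoeffAtZero g (0, 3) = B2 * s ^ 2 := by
  have hl := h.hasLead_cubic hβ hb
  rw [hB1, hB2, hr, hs] at hl
  have key := fun i j hij => hl.taylorCoeffAtZero_eq h.smooth one_pos one_pos
    (Polynomial.C (B1 * r ^ 2) * Polynomial.X ^ 3
      + Polynomial.C (2 * B1 * r * s + B2 * r ^ 2) * Polynomial.X ^ 2
      + Polynomial.C (B1 * s ^ 2 + 2 * B2 * r * s) * Polynomial.X ^ 1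
      + Polynomial.C (B2 * s ^ 2) * Polynomial.X ^ 0) (fun t => by simp; ring) (i := i) (j := j) hij
  refine ⟨?_, ?_, ?_, ?_⟩ <;> rw [key _ _ (by norm_num)] <;>
    simp only [Polynomial.coeff_add, Polynomial.coeff_C_mul, Polynomial.coeff_X_pow] <;> norm_num

/-- The cubic part is the product of the linear part of `B` with the square of that of `U`. If the
former vanishes on an axis, its other coefficient is nonzero, and the neighbouring monomial appears
instead of the pure cube. -/
theorem newtonDist_le_of_ne {β : ℝ → ℝ} (h : IsDForm g B U V b₀) (hβ : ContinuousAt β 0)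
    (hb : ∀ᶠ t in 𝓝 (0 : ℝ), b₀ t = t ^ 4 * β t) (hr : taylorCoeffAtZero U (1, 0) ≠ 0)
    (hs : taylorCoeffAtZero U (0, 1) ≠ 0) : newtonDist g ≤ ENNReal.ofReal (3 / 2) := by
  obtain ⟨h30, h21, h12, h03⟩ := h.coeff_cubic hβ hb rfl rfl rfl rfl
  obtain ⟨a, ha, hB1, hB2⟩ := h.linB
  have hdet := h.det
  have hne : taylorCoeffAtZero B (1, 0) ≠ 0 ∨ taylorCoeffAtZero B (0, 1) ≠ 0 := by
    by_contra hcon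
    push Not at hcon
    rw [hB1, hB2] at hcon
    have e1 := (mul_eq_zero.1 hcon.1).resolve_left ha
    have e2 := (mul_eq_zero.1 hcon.2).resolve_left ha
    rw [e1, e2] at hdet
    simp at hdet
  refine newtonDist_le_three_halves ?_ ?_
  · by_cases hz : taylorCoeffAtZero B (1, 0) = 0
    · right
      rw [h21, hz]
      simpa using ⟨hne.resolve_left (not_not.2 hz), hr⟩
    · left
      rw [h30]
      exact mul_ne_zero hz (pow_ne_zero _ hr)
  · by_cases hz : taylorCoeffAtZero B (0, 1) = 0
    · right
      rw [h12, hz]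
      simpa using ⟨hne.resolve_right (not_not.2 hz), hs⟩
    · left
      rw [h03]
      exact mul_ne_zero hz (pow_ne_zero _ hs)

theorem ne_zero_of_axis (h : IsDForm g B U V b₀) (hr : taylorCoeffAtZero U (1, 0) = 0) :
    taylorCoeffAtZero B (1, 0) ≠ 0 ∧ taylorCoeffAtZero V (1, 0) ≠ 0 ∧
      taylorCoeffAtZero U (0, 1) ≠ 0 := by
  obtain ⟨a, ha, hB1, -⟩ := h.linB
  have hdet := h.det
  rw [hr, mul_zero, sub_zero] at hdet
  exact ⟨hB1 ▸ mul_ne_zero ha (left_ne_zero_of_mul hdet), left_ne_zero_of_mul hdet,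
    right_ne_zero_of_mul hdet⟩

/-- For weights `(1, j)` the leading part is `a x₁ (s x₂ + δ x₁^j)²`, which contains both `x₁ x₂²`
and `x₁^(2j+1)`. -/
theorem newtonDist_le_of_order_lt {β : ℝ → ℝ} {j : ℕ} (h : IsDForm g B U V b₀)
    (hβ : ContinuousAt β 0) (hb : ∀ᶠ t in 𝓝 (0 : ℝ), b₀ t = t ^ (2 * j + 2) * β t) (hj : 2 ≤ j)
    (hU : ∀ i < j, taylorCoeffAtZero U (i, 0) = 0) (hUj : taylorCoeffAtZero U (j, 0) ≠ 0) :
    newtonDist g ≤ ENNReal.ofReal (2 * (2 * j + 1 : ℕ) / ((2 * j + 1 : ℕ) + 1)) := by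
  have hj0 : 0 < j := by omega
  obtain ⟨hB, -, hs⟩ := h.ne_zero_of_axis (hU 1 (by omega))
  have h1 := h.smoothB.hasLead_fst h.B0 one_pos (q := j) (by omega)
  have h2 := h.smoothU.hasLead_axis hU one_pos hj0 (by omega)
  -- The order `2j + 2` puts `b₀(V)` just above the weighted degree `2j + 1` of `B U²`.
  have h3 := (h.hasLead_comp one_pos hj0 (h.smoothV.hasLead_fst h.V0 one_pos (q := j) (by omega))
    hβ hb).of_lt (l := 1 + 2 * j) (by omega)
  have hl := ((h1.mul (h2.pow 2)).add h3).congr one_pos hj0 h.eq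
  simp only [one_mul, if_true, add_zero] at hl
  set a := taylorCoeffAtZero B (1, 0)
  set s := taylorCoeffAtZero U (0, 1)
  set δ := taylorCoeffAtZero U (j, 0)
  have key := fun i k hik => hl.taylorCoeffAtZero_eq h.smooth one_pos hj0
    (Polynomial.C (a * s ^ 2) * Polynomial.X ^ 1
      + Polynomial.C (2 * a * s * δ) * Polynomial.X ^ (j + 1)
      + Polynomial.C (a * δ ^ 2) * Polynomial.X ^ (2 * j + 1)) (fun t => by simp; ring)
    (i := i) (j := k) hik
  refine newtonDist_le_of_edge (by omega) ?_ ?_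
  · rw [key 1 2 (by ring)]
    simp only [Polynomial.coeff_add, Polynomial.coeff_C_mul, Polynomial.coeff_X_pow]
    rw [if_pos trivial, if_neg (by omega), if_neg (by omega)]
    simp [hB, hs]
  · rw [key (2 * j + 1) 0 (by ring)]
    simp only [Polynomial.coeff_add, Polynomial.coeff_C_mul, Polynomial.coeff_X_pow]
    rw [if_pos trivial, if_neg (by omega), if_neg (by omega)]
    simp [hB, hUj]

/-- The weights `(2, n - 1)` give `x₁ x₂²` and `x₁^n` the same degree `2n`. As `U` has order at
least `n / 2` along the axis, its contribution does not fall below this line. -/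
theorem newtonDist_le_of_le_order {β : ℝ → ℝ} {n : ℕ} (h : IsDForm g B U V b₀)
    (hβ : ContinuousAt β 0) (hβ0 : β 0 ≠ 0) (hb : ∀ᶠ t in 𝓝 (0 : ℝ), b₀ t = t ^ n * β t)
    (hn : 4 ≤ n) (hU : ∀ i < n / 2, taylorCoeffAtZero U (i, 0) = 0) :
    newtonDist g ≤ ENNReal.ofReal (2 * n / (n + 1)) := by
  have hq : 0 < n - 1 := by omega
  obtain ⟨hB, hV, hs⟩ := h.ne_zero_of_axis (hU 1 (by omega))
  have h1 := h.smoothB.hasLead_fst h.B0 two_pos (q := n - 1) (by omega)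
  have h2 := h.smoothU.hasLead_axis hU two_pos hq (by omega)
  have h3 := h.hasLead_comp two_pos hq (h.smoothV.hasLead_fst h.V0 two_pos (q := n - 1) (by omega))
    hβ hb
  rw [show n * 2 = 2 + 2 * (n - 1) by omega] at h3
  have hl := ((h1.mul (h2.pow 2)).add h3).congr two_pos hq h.eq
  set a := taylorCoeffAtZero B (1, 0)
  set s := taylorCoeffAtZero U (0, 1)
  set α := taylorCoeffAtZero V (1, 0)
  set J := n / 2 with hJ
  -- For even `n` one has `2J = n > n - 1`, so the power `x₁^J` in `U` lies above the leading
  -- degree; hence the value `0`.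
  set δ := (if n - 1 = 2 * J then taylorCoeffAtZero U (J, 0) else 0) with hδ
  have key := fun i k hik => hl.taylorCoeffAtZero_eq h.smooth two_pos hq
    (Polynomial.C (a * s ^ 2) * Polynomial.X ^ 1
      + Polynomial.C (2 * a * s * δ) * Polynomial.X ^ (J + 1)
      + Polynomial.C (a * δ ^ 2) * Polynomial.X ^ (2 * J + 1)
      + Polynomial.C (α ^ n * β 0) * Polynomial.X ^ n) (fun t => by simp; ring)
    (i := i) (j := k) hik
  have h12 : taylorCoeffAtZero g (1, 2) ≠ 0 := by
    rw [key 1 2 (by omega)]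
    simp only [Polynomial.coeff_add, Polynomial.coeff_C_mul, Polynomial.coeff_X_pow]
    rw [if_pos trivial, if_neg (by omega), if_neg (by omega), if_neg (by omega)]
    simp [hB, hs]
  by_cases hδ0 : δ = 0
  · refine newtonDist_le_of_edge (by omega) h12 ?_
    rw [key n 0 (by omega), hδ0]
    simp only [Polynomial.coeff_add, Polynomial.coeff_C_mul, Polynomial.coeff_X_pow]
    rw [if_pos trivial, if_neg (by omega)]
    simp [hV, hβ0]
  -- Here the coefficient `a δ² + α^n β(0)` of `x₁^n` may cancel, but `x₁^(J+1) x₂` lies on the same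
  -- line with coefficient `2 a s δ ≠ 0`.
  · have hodd : n - 1 = 2 * J := by
      by_contra hne
      exact hδ0 (by rw [hδ, if_neg hne])
    have hn' : n = 2 * J + 1 := by omega
    have h3 : taylorCoeffAtZero g (J + 1, 1) ≠ 0 := by
      rw [key (J + 1) 1 (by omega)]
      simp only [Polynomial.coeff_add, Polynomial.coeff_C_mul, Polynomial.coeff_X_pow]
      rw [if_pos trivial, if_neg (by omega), if_neg (by omega), if_neg (by omega)]
      simp [hB, hs, hδ0]
    rw [hn']
    exact newtonDist_le_of_edge_odd h12 h3

theorem newtonDist_le_of_axis {β : ℝ → ℝ} {n : ℕ} (h : IsDForm g B U V b₀)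
    (hβ : ContinuousAt β 0) (hβ0 : β 0 ≠ 0) (hb : ∀ᶠ t in 𝓝 (0 : ℝ), b₀ t = t ^ n * β t)
    (hn : 4 ≤ n) (hr : taylorCoeffAtZero U (1, 0) = 0) :
    newtonDist g ≤ ENNReal.ofReal (2 * n / (n + 1)) := by
  classical
  by_cases hU : ∀ i < n / 2, taylorCoeffAtZero U (i, 0) = 0
  · exact h.newtonDist_le_of_le_order hβ hβ0 hb hn hU
  · push Not at hU
    have hex : ∃ i, taylorCoeffAtZero U (i, 0) ≠ 0 := hU.imp fun i hi => hi.2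
    have hlt : Nat.find hex < n / 2 := by
      obtain ⟨i, hi, hi'⟩ := hU
      exact (Nat.find_min' hex hi').trans_lt hi
    set j := Nat.find hex with hj
    have hj0 : taylorCoeffAtZero U (j, 0) ≠ 0 := Nat.find_spec hex
    have h2j : 2 ≤ j := by
      by_contra hlt2
      rcases (by omega : j = 0 ∨ j = 1) with h' | h' <;> rw [h'] at hj0
      · exact hj0 (by rw [taylorCoeffAtZero_zero_zero, h.U0])
      · exact hj0 hr
    refine (h.newtonDist_le_of_order_lt (β := fun t => t ^ (n - (2 * j + 2)) * β t) (by fun_prop)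
      (hb.mono fun t ht => ?_) h2j (fun i hi => not_not.1 (Nat.find_min hex hi)) hj0).trans
      (two_mul_div_le (by omega))
    rw [ht, ← mul_assoc, ← pow_add]
    congr 2
    omega

/-- The monomial `x₁ x₂²` alone bounds the distance by `2`; no finite order of `b₀` is needed. -/
theorem newtonDist_le_two {β : ℝ → ℝ} (h : IsDForm g B U V b₀) (hβ : ContinuousAt β 0)
    (hb : ∀ᶠ t in 𝓝 (0 : ℝ), b₀ t = t ^ 4 * β t) (hr : taylorCoeffAtZero U (1, 0) = 0) :
    newtonDist g ≤ ENNReal.ofReal 2 := by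
  obtain ⟨hB, hV, hs⟩ := h.ne_zero_of_axis hr
  obtain ⟨-, -, h12, -⟩ := h.coeff_cubic hβ hb rfl rfl hr rfl
  have h12' : taylorCoeffAtZero g (1, 2) ≠ 0 := by
    rw [h12]; simp [hB, hs]
  exact newtonDist_le h12' h12' (by norm_num) (by norm_num) (θ := 1) (by norm_num)
    (by norm_num) (by norm_num) (by norm_num)

/-- It suffices to bound the Newton distance in coordinates where the linear part of `U` vanishes on
one of the two axes. -/
theorem newtonDist_le_of_cases {β : ℝ → ℝ} {D : ℝ} (h : IsDForm g B U V b₀)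
    (hβ : ContinuousAt β 0) (hb : ∀ᶠ t in 𝓝 (0 : ℝ), b₀ t = t ^ 4 * β t) (hD : 3 / 2 ≤ D)
    (h1 : taylorCoeffAtZero U (1, 0) = 0 → newtonDist g ≤ ENNReal.ofReal D)
    (h2 : taylorCoeffAtZero (fun x => U x.swap) (1, 0) = 0 →
      newtonDist (fun x => g x.swap) ≤ ENNReal.ofReal D) :
    newtonDist g ≤ ENNReal.ofReal D := by
  by_cases hr : taylorCoeffAtZero U (1, 0) = 0
  · exact h1 hr
  by_cases hs : taylorCoeffAtZero U (0, 1) = 0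
  · rw [← h.smooth.newtonDist_swap]
    exact h2 (by rw [h.smoothU.taylorCoeffAtZero_swap, hs])
  · exact (h.newtonDist_le_of_ne hβ hb hr hs).trans (ENNReal.ofReal_le_ofReal hD)

theorem newtonDist_le_finite {β : ℝ → ℝ} {n : ℕ} (h : IsDForm g B U V b₀)
    (hβ : ContinuousAt β 0) (hβ0 : β 0 ≠ 0) (hb : ∀ᶠ t in 𝓝 (0 : ℝ), b₀ t = t ^ n * β t)
    (hn : 4 ≤ n) : newtonDist g ≤ ENNReal.ofReal (2 * n / (n + 1)) := by
  refine h.newtonDist_le_of_cases (β := fun t => t ^ (n - 4) * β t) (by fun_prop)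
    (hb.mono fun t ht => ?_) ?_ (h.newtonDist_le_of_axis hβ hβ0 hb hn)
    (h.swap.newtonDist_le_of_axis hβ hβ0 hb hn)
  · rw [ht, ← mul_assoc, ← pow_add]
    congr 2
    omega
  · have : (4 : ℝ) ≤ n := by exact_mod_cast hn
    rw [div_le_div_iff₀ (by norm_num) (by positivity)]
    linarith

theorem newtonDist_le_flat {β : ℝ → ℝ} (h : IsDForm g B U V b₀) (hβ : ContinuousAt β 0)
    (hb : ∀ᶠ t in 𝓝 (0 : ℝ), b₀ t = t ^ 4 * β t) : newtonDist g ≤ ENNReal.ofReal 2 :=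
  h.newtonDist_le_of_cases hβ hb (by norm_num) (h.newtonDist_le_two hβ hb)
    (h.swap.newtonDist_le_two hβ hb)

end IsDForm

/-! ### Values of the heights, coordinate changes and linear invariance -/

theorem ofReal_two_mul_div (n : ℕ) :
    ENNReal.ofReal (2 * n / (n + 1)) = 2 * (n : ℝ≥0∞) / ((n : ℝ≥0∞) + 1) := by
  rw [ENNReal.ofReal_div_of_pos (by positivity), ENNReal.ofReal_mul (by norm_num),
    ENNReal.ofReal_add (by positivity) (by norm_num)]
  simp

theorem ofReal_two_mul_div_odd (m : ℕ) :
    ENNReal.ofReal (2 * (2 * m + 1 : ℕ) / ((2 * m + 1 : ℕ) + 1)) =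
      (2 * (m : ℝ≥0∞) + 1) / ((m : ℝ≥0∞) + 1) := by
  have : (2 * (2 * m + 1 : ℕ) / ((2 * m + 1 : ℕ) + 1) : ℝ) = (2 * m + 1) / (m + 1) := by
    push_cast
    field_simp
    ring
  rw [this, ENNReal.ofReal_div_of_pos (by positivity),
    ENNReal.ofReal_add (by positivity) (by norm_num),
    ENNReal.ofReal_add (by positivity) (by norm_num), ENNReal.ofReal_mul (by norm_num)]
  simp

theorem two_le_of_forall_two_mul_div_le {h : ℝ≥0∞}
    (H : ∀ N : ℕ, 4 ≤ N → ENNReal.ofReal (2 * N / (N + 1)) ≤ h) : 2 ≤ h := by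
  have h1 : Tendsto (fun N : ℕ => (2 : ℝ) * N / (N + 1)) atTop (𝓝 2) := by
    simpa [mul_div_assoc] using (tendsto_natCast_div_add_atTop (1 : ℝ)).const_mul 2
  have h2 := (ENNReal.continuous_ofReal.tendsto 2).comp h1
  rw [ENNReal.ofReal_ofNat] at h2
  exact le_of_tendsto h2 ((eventually_ge_atTop 4).mono H)

theorem SmoothNear.taylorCoeffAtZero_one_zero {f : ℝ × ℝ → ℝ} (hf : SmoothNear f 0) :
    taylorCoeffAtZero f (1, 0) = fderiv ℝ f 0 (1, 0) := by
  rw [taylorCoeffAtZero_fst, iteratedDeriv_one, Nat.factorial_one, Nat.cast_one, div_one]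
  have h1 : HasDerivAt (fun s : ℝ => (s, (0 : ℝ))) ((1 : ℝ), (0 : ℝ)) 0 :=
    (hasDerivAt_id (0 : ℝ)).prodMk (hasDerivAt_const (0 : ℝ) (0 : ℝ))
  exact ((hf.contDiffAt.differentiableAt (by simp)).hasFDerivAt.comp_hasDerivAt_of_eq
    (0 : ℝ) h1 rfl).deriv

theorem SmoothNear.taylorCoeffAtZero_zero_one {f : ℝ × ℝ → ℝ} (hf : SmoothNear f 0) :
    taylorCoeffAtZero f (0, 1) = fderiv ℝ f 0 (0, 1) := by
  simp only [taylorCoeffAtZero, partialAtZero, iteratedDeriv_zero, iteratedDeriv_one,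
    Nat.factorial, Nat.cast_one, mul_one, div_one, one_mul]
  have h1 : HasDerivAt (fun t : ℝ => ((0 : ℝ), t)) ((0 : ℝ), (1 : ℝ)) 0 :=
    (hasDerivAt_const (0 : ℝ) (0 : ℝ)).prodMk (hasDerivAt_id (0 : ℝ))
  exact ((hf.contDiffAt.differentiableAt (by simp)).hasFDerivAt.comp_hasDerivAt_of_eq
    (0 : ℝ) h1 rfl).deriv

theorem ContinuousLinearMap.det_ne_zero_of_injective {A : ℝ × ℝ →L[ℝ] ℝ × ℝ}
    (hA : Function.Injective A) :
    (A (1, 0)).1 * (A (0, 1)).2 - (A (0, 1)).1 * (A (1, 0)).2 ≠ 0 := by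
  intro h
  have hv : ∀ u v : ℝ, A (u, v) = u • A (1, 0) + v • A (0, 1) := fun u v => by
    rw [← map_smul, ← map_smul, ← map_add]; simp
  have hker : ∀ u v : ℝ, u * (A (1, 0)).1 + v * (A (0, 1)).1 = 0 →
      u * (A (1, 0)).2 + v * (A (0, 1)).2 = 0 → u = 0 ∧ v = 0 := by
    intro u v h1 h2
    have : A (u, v) = A 0 := by
      rw [hv, map_zero]
      exact Prod.ext (by simpa using h1) (by simpa using h2)
    simpa using hA this
  -- Up to sign, the test vectors are the columns of the adjugate, which a singular matrix
  -- annihilates; injectivity then makes every entry vanish.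
  obtain ⟨h1, h2⟩ := hker (A (0, 1)).1 (-(A (1, 0)).1) (by ring) (by linarith)
  obtain ⟨h3, h4⟩ := hker (A (0, 1)).2 (-(A (1, 0)).2) (by linarith) (by ring)
  have := hker 1 0 (by linarith) (by linarith)
  exact one_ne_zero this.1

theorem ContinuousLinearEquiv.isLocalCoordinateChange (L : (ℝ × ℝ) ≃L[ℝ] (ℝ × ℝ)) :
    IsLocalCoordinateChange L := by
  refine ⟨L.contDiff.smoothNear 0, map_zero L, ?_⟩
  rw [L.fderiv]
  exact ⟨L, rfl⟩

theorem IsLocalCoordinateChange.comp_equiv {Ψ : ℝ × ℝ → ℝ × ℝ} (h : IsLocalCoordinateChange Ψ)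
    (L : (ℝ × ℝ) ≃L[ℝ] (ℝ × ℝ)) : IsLocalCoordinateChange (fun x => L (Ψ x)) := by
  obtain ⟨h1, h2, A, hA⟩ := h
  refine ⟨SmoothNear.comp (f := L) (L.contDiff.smoothNear _) h1, by simp [h2],
    A.trans L, ?_⟩
  have := L.comp_fderiv (f := Ψ) (x := 0)
  rw [Function.comp_def] at this
  rw [this, ← hA]
  rfl

theorem height_comp_equiv_le (φ : ℝ × ℝ → ℝ) (L : (ℝ × ℝ) ≃L[ℝ] (ℝ × ℝ)) :
    height (fun x => φ (L x)) ≤ height φ :=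
  iSup₂_le fun Ψ hΨ => le_iSup₂_of_le (fun x => L (Ψ x)) (hΨ.comp_equiv L) le_rfl

theorem height_comp_equiv (φ : ℝ × ℝ → ℝ) (L : (ℝ × ℝ) ≃L[ℝ] (ℝ × ℝ)) :
    height (fun x => φ (L x)) = height φ := by
  refine le_antisymm (height_comp_equiv_le φ L) ?_
  simpa using height_comp_equiv_le (fun x => φ (L x)) L.symm

theorem linHeight_comp_equiv_le (φ : ℝ × ℝ → ℝ) (L : (ℝ × ℝ) ≃L[ℝ] (ℝ × ℝ)) :
    linHeight (fun x => φ (L x)) ≤ linHeight φ :=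
  iSup_le fun L' => le_iSup_of_le (L'.trans L) le_rfl

theorem linHeight_comp_equiv (φ : ℝ × ℝ → ℝ) (L : (ℝ × ℝ) ≃L[ℝ] (ℝ × ℝ)) :
    linHeight (fun x => φ (L x)) = linHeight φ := by
  refine le_antisymm (linHeight_comp_equiv_le φ L) ?_
  simpa using linHeight_comp_equiv_le (fun x => φ (L x)) L.symm

theorem newtonDist_le_linHeight (φ : ℝ × ℝ → ℝ) : newtonDist φ ≤ linHeight φ :=
  le_iSup_of_le (ContinuousLinearEquiv.refl ℝ (ℝ × ℝ)) le_rfl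

theorem newtonDist_comp_le_height {φ Ψ} (h : IsLocalCoordinateChange Ψ) :
    newtonDist (fun x => φ (Ψ x)) ≤ height φ :=
  le_iSup₂_of_le Ψ h le_rfl

/-! ### Heights of `b (x₂ - ψ(x₁))² + b₀(x₁)` -/

/-- The lower bound for the Newton distance of `b (x₂ - ψ(x₁))² + b₀(x₁)`. -/
theorem le_newtonDist_of_eq {f b : ℝ × ℝ → ℝ} {ψ b₀ w β : ℝ → ℝ} {M N : ℕ} (hf : SmoothNear f 0)
    (hfe : f =ᶠ[𝓝 0] fun x => b x * (x.2 - ψ x.1) ^ 2 + b₀ x.1) (hb : SmoothNear b 0)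
    (hb0 : b 0 = 0) (hN : 4 ≤ N) (hw : ContinuousAt w 0) (hψ : ∀ᶠ t in 𝓝 (0 : ℝ), ψ t = t ^ M * w t)
    (hM : N ≤ 2 * M + 1) (hβ : ContinuousAt β 0) (hb₀ : ∀ᶠ t in 𝓝 (0 : ℝ), b₀ t = t ^ N * β t) :
    ENNReal.ofReal (2 * N / (N + 1)) ≤ newtonDist f := by
  have hq : 0 < N - 1 := by omega
  have h1 := hb.hasLead_fst hb0 two_pos (q := N - 1) (by omega)
  have hfst : ContinuousAt (fun x : ℝ × ℝ => x.1) 0 := continuous_fst.continuousAt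
  have h2 := (HasLead.fst (p := 2) (N - 1)).comp_pow_mul two_pos hq hfst rfl hw hψ
  -- Only the weighted degree of `ψ` matters for a lower bound, so the leading part may remain
  -- unspecified; it is zero when `2M > N - 1`.
  have h2' : ∃ P, HasLead (fun x : ℝ × ℝ => ψ x.1) 2 (N - 1) (N - 1) P := by
    rcases (by omega : M * 2 = N - 1 ∨ N - 1 < M * 2) with h | h
    · rw [h] at h2; exact ⟨_, h2⟩
    · exact ⟨_, h2.of_lt h⟩
  obtain ⟨P, hP⟩ := h2'
  have h3 := (HasLead.fst (p := 2) (N - 1)).comp_pow_mul two_pos hq hfst rfl hβ hb₀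
  rw [show N * 2 = 2 + 2 * (N - 1) by omega] at h3
  have hl := ((h1.mul (((HasLead.snd 2).sub hP).pow 2)).add h3).congr two_pos hq hfe
  have := le_newtonDist (f := f) (p := 2) (q := N - 1) (l := 2 * N) (by omega) fun i j _ hij =>
    hl.taylorCoeffAtZero_eq_zero hf two_pos hq i j (by omega)
  convert this using 2
  push_cast [Nat.cast_sub (by omega : 1 ≤ N)]
  ring

/-- `F = b (x₂ - ψ(x₁))² + b₀(x₁)` near the origin, where `b` has linear part a nonzero multiple of
`x₁` and `ψ` vanishes to second order. -/
structure IsStdForm (F b : ℝ × ℝ → ℝ) (ψ b₀ : ℝ → ℝ) : Prop where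
  eq : F =ᶠ[𝓝 0] fun x => b x * (x.2 - ψ x.1) ^ 2 + b₀ x.1
  smooth_b : SmoothNear b 0
  smooth_ψ : SmoothNear ψ 0
  smooth₀ : SmoothNear b₀ 0
  b0 : b 0 = 0
  b10 : taylorCoeffAtZero b (1, 0) ≠ 0
  b01 : taylorCoeffAtZero b (0, 1) = 0
  ψ_eq : ∃ ζ : ℝ → ℝ, ContinuousAt ζ 0 ∧ ∀ᶠ t in 𝓝 (0 : ℝ), ψ t = t ^ 2 * ζ t

namespace IsStdForm

variable {F b : ℝ × ℝ → ℝ} {ψ b₀ : ℝ → ℝ}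

theorem ψ0 (h : IsStdForm F b ψ b₀) : ψ 0 = 0 := by
  obtain ⟨ζ, -, hψ⟩ := h.ψ_eq
  simpa using hψ.self_of_nhds

theorem smooth (h : IsStdForm F b ψ b₀) : SmoothNear F 0 := by
  have h1 : SmoothNear (fun x : ℝ × ℝ => x.1) 0 := contDiff_fst.smoothNear 0
  have h2 : SmoothNear (fun x : ℝ × ℝ => x.2) 0 := contDiff_snd.smoothNear 0
  exact ((h.smooth_b.mul ((h2.sub (SmoothNear.comp (f := ψ) h.smooth_ψ h1)).pow 2)).add
    (SmoothNear.comp (f := b₀) h.smooth₀ h1)).congr h.eq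

theorem hasLead_snd_sub (h : IsStdForm F b ψ b₀) {X : ℝ × ℝ → ℝ × ℝ}
    (hX : SmoothNear X 0) (hX0 : X 0 = 0) :
    HasLead (fun x => (X x).2 - ψ (X x).1) 1 1 1
      (fun x => taylorCoeffAtZero (fun x => (X x).2) (1, 0) * x.1 +
        taylorCoeffAtZero (fun x => (X x).2) (0, 1) * x.2) := by
  obtain ⟨ζ, hζ, hψ⟩ := h.ψ_eq
  have h1 := hX.fst.hasLead_linear (by rw [hX0]; rfl)
  have h2 := hX.snd.hasLead_linear (by rw [hX0]; rfl)
  have h3 := (h1.comp_pow_mul one_pos one_pos hX.fst.contDiffAt.continuousAt (by rw [hX0]; rfl)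
    hζ hψ).of_lt (l := 1) (by norm_num)
  exact (h2.sub h3).congr_lead fun x => sub_zero _

theorem smooth_snd_sub (h : IsStdForm F b ψ b₀) {X : ℝ × ℝ → ℝ × ℝ}
    (hX : SmoothNear X 0) (hX0 : X 0 = 0) : SmoothNear (fun x => (X x).2 - ψ (X x).1) 0 := by
  refine hX.snd.sub (SmoothNear.comp (f := ψ) ?_ hX.fst)
  rw [hX0]
  exact h.smooth_ψ

theorem coeff_snd_sub (h : IsStdForm F b ψ b₀) {X : ℝ × ℝ → ℝ × ℝ}
    (hX : SmoothNear X 0) (hX0 : X 0 = 0) :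
    taylorCoeffAtZero (fun x => (X x).2 - ψ (X x).1) (1, 0) = (fderiv ℝ X 0 (1, 0)).2 ∧
    taylorCoeffAtZero (fun x => (X x).2 - ψ (X x).1) (0, 1) = (fderiv ℝ X 0 (0, 1)).2 := by
  have hd : DifferentiableAt ℝ X 0 := hX.contDiffAt.differentiableAt (by simp)
  have hd' := hd.hasFDerivAt.snd.fderiv
  have hl := h.hasLead_snd_sub hX hX0
  have key := fun i j hij => hl.taylorCoeffAtZero_eq (h.smooth_snd_sub hX hX0) one_pos one_pos
    (Polynomial.C (taylorCoeffAtZero (fun x => (X x).2) (1, 0)) * Polynomial.X +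
      Polynomial.C (taylorCoeffAtZero (fun x => (X x).2) (0, 1))) (fun t => by simp)
    (i := i) (j := j) hij
  rw [key 1 0 (by norm_num), key 0 1 (by norm_num), hX.snd.taylorCoeffAtZero_one_zero,
    hX.snd.taylorCoeffAtZero_zero_one, hd']
  simp

/-- As `ψ` vanishes to second order and `b` has no linear `x₂` term, the linear parts of `U`, `V`
and `B` are those of `X₂`, `X₁` and a multiple of `X₁`; the determinant is that of the differential
of `X`. -/
theorem isDForm_comp (h : IsStdForm F b ψ b₀) {X : ℝ × ℝ → ℝ × ℝ}
    (hX : IsLocalCoordinateChange X) :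
    IsDForm (fun x => F (X x)) (fun x => b (X x)) (fun x => (X x).2 - ψ (X x).1)
      (fun x => (X x).1) b₀ where
  eq := by
    have : Tendsto X (𝓝 0) (𝓝 0) := by simpa [hX.2.1] using hX.1.contDiffAt.continuousAt.tendsto
    exact this.eventually h.eq
  smoothB := SmoothNear.comp (f := b) (by rw [hX.2.1]; exact h.smooth_b) hX.1
  smoothU := h.smooth_snd_sub hX.1 hX.2.1
  smoothV := hX.1.fst
  smooth₀ := h.smooth₀
  B0 := by simp only [hX.2.1, h.b0]
  U0 := by simp [hX.2.1, h.ψ0]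
  V0 := by simp [hX.2.1]
  linB := by
    refine ⟨_, h.b10, ?_⟩
    have hB : SmoothNear (fun x => b (X x)) 0 :=
      SmoothNear.comp (f := b) (by rw [hX.2.1]; exact h.smooth_b) hX.1
    have hl := (h.smooth_b.hasLead_linear h.b0).comp
      (hX.1.fst.hasLead_linear (by simp [hX.2.1])) (hX.1.snd.hasLead_linear (by simp [hX.2.1]))
    have key := fun i j hij => hl.taylorCoeffAtZero_eq hB one_pos one_pos
      (Polynomial.C (taylorCoeffAtZero b (1, 0) * taylorCoeffAtZero (fun x => (X x).1) (1, 0)) *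
        Polynomial.X +
        Polynomial.C (taylorCoeffAtZero b (1, 0) * taylorCoeffAtZero (fun x => (X x).1) (0, 1)))
      (fun t => by simp [h.b01]; ring) (i := i) (j := j) hij
    constructor
    · rw [key 1 0 (by norm_num)]; simp [-map_mul]
    · rw [key 0 1 (by norm_num)]; simp [-map_mul]
  det := by
    obtain ⟨h1, h2⟩ := h.coeff_snd_sub hX.1 hX.2.1
    have hd : DifferentiableAt ℝ X 0 := hX.1.contDiffAt.differentiableAt (by simp)
    have hd' := hd.hasFDerivAt.fst.fderiv
    rw [h1, h2, hX.1.fst.taylorCoeffAtZero_one_zero, hX.1.fst.taylorCoeffAtZero_zero_one, hd']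
    obtain ⟨A, hA⟩ := hX.2.2
    exact ContinuousLinearMap.det_ne_zero_of_injective (by rw [← hA]; exact A.injective)

theorem height_le {β : ℝ → ℝ} {n : ℕ} (h : IsStdForm F b ψ b₀) (hβ : ContinuousAt β 0)
    (hβ0 : β 0 ≠ 0) (hb : ∀ᶠ t in 𝓝 (0 : ℝ), b₀ t = t ^ n * β t) (hn : 4 ≤ n) :
    height F ≤ ENNReal.ofReal (2 * n / (n + 1)) :=
  iSup₂_le fun _ hX => (h.isDForm_comp hX).newtonDist_le_finite hβ hβ0 hb hn

theorem height_le_two {β : ℝ → ℝ} (h : IsStdForm F b ψ b₀) (hβ : ContinuousAt β 0)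
    (hb : ∀ᶠ t in 𝓝 (0 : ℝ), b₀ t = t ^ 4 * β t) : height F ≤ ENNReal.ofReal 2 :=
  iSup₂_le fun _ hX => (h.isDForm_comp hX).newtonDist_le_flat hβ hb

theorem le_linHeight {w β : ℝ → ℝ} {M N : ℕ} (h : IsStdForm F b ψ b₀) (hN : 4 ≤ N)
    (hw : ContinuousAt w 0) (hψ : ∀ᶠ t in 𝓝 (0 : ℝ), ψ t = t ^ M * w t) (hM : N ≤ 2 * M + 1)
    (hβ : ContinuousAt β 0) (hb₀ : ∀ᶠ t in 𝓝 (0 : ℝ), b₀ t = t ^ N * β t) :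
    ENNReal.ofReal (2 * N / (N + 1)) ≤ linHeight F :=
  (le_newtonDist_of_eq h.smooth h.eq h.smooth_b h.b0 hN hw hψ hM hβ hb₀).trans
    (newtonDist_le_linHeight F)

/-- Since `ψ` vanishes to second order, the differential of the shear at the origin is the identity.
-/
theorem isLocalCoordinateChange_shear (h : IsStdForm F b ψ b₀) :
    IsLocalCoordinateChange (fun y : ℝ × ℝ => (y.1, y.2 + ψ y.1)) := by
  have h1 : SmoothNear (fun x : ℝ × ℝ => x.1) 0 := contDiff_fst.smoothNear 0
  have h2 : SmoothNear (fun x : ℝ × ℝ => x.2) 0 := contDiff_snd.smoothNear 0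
  refine ⟨h1.prodMk (h2.add (SmoothNear.comp (f := ψ) h.smooth_ψ h1)), by simp [h.ψ0], ?_⟩
  obtain ⟨ζ, hζ, hψ⟩ := h.ψ_eq
  have hd : HasDerivAt ψ 0 0 := by
    rw [hasDerivAt_iff_isLittleO_nhds_zero]
    have h3 : Tendsto (fun t : ℝ => t * ζ t) (𝓝 0) (𝓝 0) := by
      simpa using (continuousAt_id (x := (0 : ℝ))).tendsto.mul hζ.tendsto
    have h4 := ((Asymptotics.isLittleO_one_iff ℝ).2 h3).mul_isBigO
      (Asymptotics.isBigO_refl (fun t : ℝ => t) (𝓝 0))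
    refine h4.congr' (hψ.mono fun t ht => ?_) (Eventually.of_forall fun t => one_mul t)
    simp only [zero_add, h.ψ0, ht, smul_zero, sub_zero]
    ring
  have hd2 : HasFDerivAt (fun y : ℝ × ℝ => (y.1, y.2 + ψ y.1))
      (ContinuousLinearMap.id ℝ (ℝ × ℝ)) 0 := by
    have h5 := hd.comp_hasFDerivAt_of_eq (0 : ℝ × ℝ) (hasFDerivAt_fst (𝕜 := ℝ) (F := ℝ)) rfl
    have h6 := (hasFDerivAt_fst (𝕜 := ℝ) (p := (0 : ℝ × ℝ))).prodMk
      ((hasFDerivAt_snd (𝕜 := ℝ) (p := (0 : ℝ × ℝ))).add h5)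
    refine h6.congr_fderiv ?_
    ext <;> simp
  rw [hd2.fderiv]
  exact ⟨ContinuousLinearEquiv.refl ℝ _, rfl⟩

theorem le_height {β : ℝ → ℝ} {N : ℕ} (h : IsStdForm F b ψ b₀) (hN : 4 ≤ N)
    (hβ : ContinuousAt β 0) (hb₀ : ∀ᶠ t in 𝓝 (0 : ℝ), b₀ t = t ^ N * β t) :
    ENNReal.ofReal (2 * N / (N + 1)) ≤ height F := by
  have hX := h.isLocalCoordinateChange_shear
  have hD := h.isDForm_comp hX
  refine le_trans ?_ (newtonDist_comp_le_height hX)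
  -- The shear has straightened the curve, so the lower bound applies with `ψ = 0`, for which any
  -- large `M` is admissible.
  refine le_newtonDist_of_eq (ψ := fun _ => 0) (w := fun _ => 0) (M := N) hD.smooth
    (hD.eq.trans (Eventually.of_forall fun x => ?_)) hD.smoothB hD.B0 hN continuousAt_const
    (by simp) (by omega) hβ hb₀
  simp

/-- Linearity enters here: the vanishing coefficient makes the second component of `L` vanish
identically on the first axis. There `U` reduces to `-ψ` of a nonzero multiple of `x₁`, so its order
is exactly `m`. -/
theorem newtonDist_le_of_axis {w β : ℝ → ℝ} {m : ℕ} (h : IsStdForm F b ψ b₀) (hm : 2 ≤ m)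
    (hw : ContinuousAt w 0) (hw0 : w 0 ≠ 0) (hψ : ∀ᶠ t in 𝓝 (0 : ℝ), ψ t = t ^ m * w t)
    (hβ : ContinuousAt β 0) (hb : ∀ᶠ t in 𝓝 (0 : ℝ), b₀ t = t ^ (2 * m + 2) * β t)
    (L : (ℝ × ℝ) ≃L[ℝ] (ℝ × ℝ))
    (hr : taylorCoeffAtZero (fun x => (L x).2 - ψ (L x).1) (1, 0) = 0) :
    newtonDist (fun x => F (L x)) ≤
      ENNReal.ofReal (2 * (2 * m + 1 : ℕ) / ((2 * m + 1 : ℕ) + 1)) := by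
  have hm0 : 0 < m := by omega
  have hL := L.isLocalCoordinateChange
  have hD := h.isDForm_comp hL
  obtain ⟨-, hV, hU⟩ := hD.ne_zero_of_axis hr
  have h1 := hL.1.fst.hasLead_fst (by simp) one_pos (q := m) (by omega)
  have h2 := h1.comp_pow_mul one_pos hm0 hL.1.fst.contDiffAt.continuousAt (by simp) hw hψ
  rw [mul_one] at h2
  have h3 : HasLead (fun x => (L x).2) 1 m m
      (fun x => taylorCoeffAtZero (fun x => (L x).2 - ψ (L x).1) (0, 1) * x.2) := by
    obtain ⟨e1, e2⟩ := h.coeff_snd_sub hL.1 hL.2.1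
    rw [L.fderiv] at e1 e2
    refine ((HasLead.snd 1).const_mul _).congr one_pos hm0 (Eventually.of_forall fun x => ?_)
    have : x = x.1 • ((1 : ℝ), (0 : ℝ)) + x.2 • ((0 : ℝ), (1 : ℝ)) := by simp
    have h4 : L x = x.1 • L (1, 0) + x.2 • L (0, 1) := by
      conv_lhs => rw [this]
      rw [map_add, map_smul, map_smul]
    have e1' : (L (1, 0)).2 = 0 := e1.symm.trans hr
    beta_reduce
    rw [h4, e2]
    simp [e1', mul_comm]
  have hl := h3.sub h2
  set s := taylorCoeffAtZero (fun x => (L x).2 - ψ (L x).1) (0, 1)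
  set α := taylorCoeffAtZero (fun x => (L x).1) (1, 0)
  refine hD.newtonDist_le_of_order_lt hβ hb hm
    (fun i hi => hl.taylorCoeffAtZero_eq_zero hD.smoothU one_pos hm0 i 0 (by omega)) ?_
  rw [hl.taylorCoeffAtZero_eq hD.smoothU one_pos hm0
    (Polynomial.C s - Polynomial.C (α ^ m * w 0) * Polynomial.X ^ m)
    (fun t => by simp; ring) (i := m) (j := 0) (by ring)]
  simp only [Polynomial.coeff_sub, Polynomial.coeff_C_mul, Polynomial.coeff_X_pow,
    Polynomial.coeff_C]
  rw [if_neg (by omega), if_pos trivial]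
  simp [hw0, hV]

theorem linHeight_le {w β : ℝ → ℝ} {m : ℕ} (h : IsStdForm F b ψ b₀) (hm : 2 ≤ m)
    (hw : ContinuousAt w 0) (hw0 : w 0 ≠ 0) (hψ : ∀ᶠ t in 𝓝 (0 : ℝ), ψ t = t ^ m * w t)
    (hβ : ContinuousAt β 0) (hb : ∀ᶠ t in 𝓝 (0 : ℝ), b₀ t = t ^ (2 * m + 2) * β t) :
    linHeight F ≤ ENNReal.ofReal (2 * (2 * m + 1 : ℕ) / ((2 * m + 1 : ℕ) + 1)) := by
  refine iSup_le fun L => ?_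
  refine (h.isDForm_comp L.isLocalCoordinateChange).newtonDist_le_of_cases
    (β := fun t => t ^ (2 * m + 2 - 4) * β t) (by fun_prop) (hb.mono fun t ht => ?_) ?_
    (h.newtonDist_le_of_axis hm hw hw0 hψ hβ hb L) (h.newtonDist_le_of_axis hm hw hw0 hψ hβ hb
      ((ContinuousLinearEquiv.prodComm ℝ ℝ ℝ).trans L))
  · rw [ht, ← mul_assoc, ← pow_add]
    congr 2
    omega
  · have : (2 : ℝ) ≤ m := by exact_mod_cast hm
    push_cast
    rw [div_le_div_iff₀ (by norm_num) (by positivity)]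
    linarith

end IsStdForm

/-! ### Consequences of the normal form -/

theorem SmoothNear.exists_eq_pow_mul {f : ℝ → ℝ} (hf : SmoothNear f 0)
    (h : ∀ i, iteratedDeriv i f 0 = 0) (N : ℕ) :
    ∃ g : ℝ → ℝ, ContDiff ℝ ∞ g ∧ ∀ᶠ t in 𝓝 (0 : ℝ), f t = t ^ N * g t := by
  obtain ⟨F, hF, hfF⟩ := hf.exists_contDiff
  obtain ⟨g, hg, hFg, -⟩ := hF.exists_eq_pow_mul (N := N) fun i _ => by
    rw [← hfF.iteratedDeriv_eq]; exact h i
  exact ⟨g, hg, hfF.mono fun t ht => by rw [ht, hFg]⟩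

/-- With equal weights only the differential of `X` reaches the leading part, even for nonlinear
`X`. -/
theorem HasLead.comp_linear {F : ℝ × ℝ → ℝ} {k : ℕ} {P : ℝ × ℝ → ℝ} (h : HasLead F 1 1 k P)
    {X : ℝ × ℝ → ℝ × ℝ} (hX : SmoothNear X 0) (hX0 : X 0 = 0) :
    HasLead (fun x => F (X x)) 1 1 k (fun x => P (fderiv ℝ X 0 x)) := by
  have hd := (hX.contDiffAt.differentiableAt (by simp)).hasFDerivAt
  refine (h.comp (hX.fst.hasLead_linear (by simp [hX0]))
    (hX.snd.hasLead_linear (by simp [hX0]))).congr_lead fun x => ?_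
  have hx : fderiv ℝ X 0 x = x.1 • fderiv ℝ X 0 (1, 0) + x.2 • fderiv ℝ X 0 (0, 1) := by
    rw [← map_smul, ← map_smul, ← map_add]; simp
  rw [hX.fst.taylorCoeffAtZero_one_zero, hX.fst.taylorCoeffAtZero_zero_one,
    hX.snd.taylorCoeffAtZero_one_zero, hX.snd.taylorCoeffAtZero_zero_one, hd.fst.fderiv,
    hd.snd.fderiv, hx]
  congr 1
  ext <;> simp [mul_comm]

/-- Composing with `L.symm` exhibits `φ` itself as `B U² + b₀(V)`, whose leading part for equal
weights has degree `3`. -/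
theorem IsStdForm.partialAtZero_eq_zero {φ b : ℝ × ℝ → ℝ} {ψ b₀ β : ℝ → ℝ}
    {L : (ℝ × ℝ) ≃L[ℝ] (ℝ × ℝ)} (hφ : SmoothNear φ 0)
    (h : IsStdForm (fun x => φ (L x)) b ψ b₀) (hβ : ContinuousAt β 0)
    (hb : ∀ᶠ t in 𝓝 (0 : ℝ), b₀ t = t ^ 4 * β t) (i j : ℕ) (hij : i + j ≤ 2) :
    partialAtZero i j φ = 0 := by
  have hX := L.symm.isLocalCoordinateChange
  have h1 := (h.isDForm_comp hX).hasLead_cubic hβ hb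
  simp only [ContinuousLinearEquiv.apply_symm_apply] at h1
  exact taylorCoeffAtZero_eq_zero_iff.1
    (h1.taylorCoeffAtZero_eq_zero hφ one_pos one_pos i j (by omega))

theorem ofReal_two_mul_div_lt {k n : ℕ} (hkn : k < n) :
    ENNReal.ofReal (2 * k / (k + 1)) < ENNReal.ofReal (2 * n / (n + 1)) := by
  have h0 : (0 : ℝ) < n := by exact_mod_cast (Nat.zero_le k).trans_lt hkn
  rw [ENNReal.ofReal_lt_ofReal_iff (by positivity)]
  have : (k : ℝ) < n := by exact_mod_cast hkn
  rw [div_lt_div_iff₀ (by positivity) (by positivity)]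
  nlinarith

theorem ofReal_two_mul_div_lt_two (n : ℕ) : ENNReal.ofReal (2 * n / (n + 1)) < 2 := by
  rw [← ENNReal.ofReal_ofNat, ENNReal.ofReal_lt_ofReal_iff (by norm_num),
    div_lt_iff₀ (by positivity)]
  linarith

theorem HasNormalForm.exists_isStdForm {φ : ℝ × ℝ → ℝ} {m : ℕ} {n : ℕ∞}
    (h : HasNormalForm φ m n) :
    ∃ (L : (ℝ × ℝ) ≃L[ℝ] (ℝ × ℝ)) (b : ℝ × ℝ → ℝ) (w ψ b₀ : ℝ → ℝ),
      IsStdForm (fun x => φ (L x)) b ψ b₀ ∧ 2 ≤ m ∧ ContinuousAt w 0 ∧ w 0 ≠ 0 ∧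
      (∀ᶠ t in 𝓝 (0 : ℝ), ψ t = t ^ m * w t) ∧ ((2 * m + 1 : ℕ) : ℕ∞) < n ∧
      HasVanishingOrder b₀ n := by
  obtain ⟨L, b, w, b₀, hb, hw, hb₀, heq, hb0, hb10, hb01, hm, hw0, hn, hv⟩ := h
  have hw' := hw.contDiffAt.continuousAt
  refine ⟨L, b, w, fun t => t ^ m * w t, b₀, ⟨heq, hb, ?_, hb₀, hb0, ?_, ?_, ?_⟩, hm, hw', hw0,
    Eventually.of_forall fun _ => rfl, hn, hv⟩
  · exact SmoothNear.mul (ContDiff.smoothNear (by fun_prop) 0) hw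
  · exact fun h => hb10 (taylorCoeffAtZero_eq_zero_iff.1 h)
  · exact taylorCoeffAtZero_eq_zero_iff.2 hb01
  · refine ⟨fun t => t ^ (m - 2) * w t, by fun_prop, Eventually.of_forall fun t => ?_⟩
    rw [← mul_assoc, ← pow_add]
    congr 2
    omega

/-- Lowering the order of vanishing in a factorization. -/
theorem eventually_eq_pow_mul_of_le {f β : ℝ → ℝ} {N k : ℕ} (hβ : ContinuousAt β 0)
    (h : ∀ᶠ t in 𝓝 (0 : ℝ), f t = t ^ N * β t) (hk : k ≤ N) :
    ∃ γ : ℝ → ℝ, ContinuousAt γ 0 ∧ ∀ᶠ t in 𝓝 (0 : ℝ), f t = t ^ k * γ t := by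
  refine ⟨fun t => t ^ (N - k) * β t, by fun_prop, h.mono fun t ht => ?_⟩
  rw [ht, ← mul_assoc, ← pow_add]
  congr 2
  omega

theorem HasNormalForm.height_eq_natCast {φ : ℝ × ℝ → ℝ} {m k : ℕ}
    (h : HasNormalForm φ m (k : ℕ∞)) : height φ = ENNReal.ofReal (2 * k / (k + 1)) := by
  obtain ⟨L, b, w, ψ, b₀, hS, hm, hw, hw0, hψ, hn, hv⟩ := h.exists_isStdForm
  have hk : 2 * m + 1 < k := by exact_mod_cast hn
  obtain ⟨k', hk', β, hβ, hβ0, hb⟩ := hv.resolve_right fun h => ENat.natCast_ne_top k h.1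
  obtain rfl : k = k' := by exact_mod_cast hk'
  have hβ' := hβ.contDiffAt.continuousAt
  rw [← height_comp_equiv φ L]
  exact le_antisymm (hS.height_le hβ' hβ0 hb (by omega)) (hS.le_height (by omega) hβ' hb)

theorem HasNormalForm.height_eq_two {φ : ℝ × ℝ → ℝ} {m : ℕ} (h : HasNormalForm φ m ⊤) :
    height φ = 2 := by
  obtain ⟨L, b, w, ψ, b₀, hS, hm, hw, hw0, hψ, hn, hv⟩ := h.exists_isStdForm
  obtain ⟨-, hflat⟩ := hv.resolve_left fun ⟨k, hk, _⟩ => ENat.natCast_ne_top k hk.symm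
  rw [← height_comp_equiv φ L]
  refine le_antisymm ?_ (two_le_of_forall_two_mul_div_le fun N hN => ?_)
  · obtain ⟨β, hβ, hb⟩ := hS.smooth₀.exists_eq_pow_mul hflat 4
    simpa using hS.height_le_two hβ.continuous.continuousAt hb
  · obtain ⟨β, hβ, hb⟩ := hS.smooth₀.exists_eq_pow_mul hflat N
    exact hS.le_height hN hβ.continuous.continuousAt hb

theorem HasVanishingOrder.exists_eq_pow_mul {b₀ : ℝ → ℝ} {n : ℕ∞} (h : HasVanishingOrder b₀ n)
    (hb₀ : SmoothNear b₀ 0) {N : ℕ} (hN : (N : ℕ∞) ≤ n) :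
    ∃ β : ℝ → ℝ, ContinuousAt β 0 ∧ ∀ᶠ t in 𝓝 (0 : ℝ), b₀ t = t ^ N * β t := by
  rcases h with ⟨k, rfl, β, hβ, -, hb⟩ | ⟨rfl, hflat⟩
  · exact eventually_eq_pow_mul_of_le hβ.contDiffAt.continuousAt hb (by exact_mod_cast hN)
  · obtain ⟨β, hβ, hb⟩ := hb₀.exists_eq_pow_mul hflat N
    exact ⟨β, hβ.continuous.continuousAt, hb⟩

theorem HasNormalForm.linHeight_eq {φ : ℝ × ℝ → ℝ} {m : ℕ} {n : ℕ∞} (h : HasNormalForm φ m n) :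
    linHeight φ = ENNReal.ofReal (2 * (2 * m + 1 : ℕ) / ((2 * m + 1 : ℕ) + 1)) := by
  obtain ⟨L, b, w, ψ, b₀, hS, hm, hw, hw0, hψ, hn, hv⟩ := h.exists_isStdForm
  -- The upper bound needs `b₀` strictly above the edge, hence `2m + 2`; the lower bound below needs
  -- only `2m + 1`.
  obtain ⟨β, hβ, hb⟩ := hv.exists_eq_pow_mul hS.smooth₀ (N := 2 * m + 2)
    (Order.add_one_le_of_lt hn)
  obtain ⟨γ, hγ, hb'⟩ := hv.exists_eq_pow_mul hS.smooth₀ (N := 2 * m + 1) hn.le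
  rw [← linHeight_comp_equiv φ L]
  exact le_antisymm (hS.linHeight_le hm hw hw0 hψ hβ hb)
    (hS.le_linHeight (by omega) hw hψ le_rfl hγ hb')

theorem HasNormalForm.partialAtZero_eq_zero {φ : ℝ × ℝ → ℝ} (hφ : SmoothNear φ 0) {m : ℕ} {n : ℕ∞}
    (h : HasNormalForm φ m n) (i j : ℕ) (hij : i + j ≤ 2) : partialAtZero i j φ = 0 := by
  obtain ⟨L, b, w, ψ, b₀, hS, hm, hw, hw0, hψ, hn, hv⟩ := h.exists_isStdForm
  obtain ⟨β, hβ, hb⟩ := hv.exists_eq_pow_mul hS.smooth₀ (N := 4)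
    (le_trans (by exact_mod_cast (by omega : 4 ≤ 2 * m + 1)) hn.le)
  exact hS.partialAtZero_eq_zero hφ hβ hb i j hij

theorem HasNormalForm.height_le_two_and_lt {φ : ℝ × ℝ → ℝ} {m : ℕ} {n : ℕ∞}
    (h : HasNormalForm φ m n) : height φ ≤ 2 ∧ linHeight φ < height φ := by
  rw [h.linHeight_eq]
  have hn : ((2 * m + 1 : ℕ) : ℕ∞) < n := by
    obtain ⟨L, b, w, ψ, b₀, hS, hm, hw, hw0, hψ, hn, hv⟩ := h.exists_isStdForm
    exact hn
  induction n using ENat.recTopCoe with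
  | top =>
    rw [h.height_eq_two]
    exact ⟨le_rfl, ofReal_two_mul_div_lt_two _⟩
  | coe k =>
    rw [h.height_eq_natCast]
    exact ⟨(ofReal_two_mul_div_lt_two k).le, ofReal_two_mul_div_lt (by exact_mod_cast hn)⟩

/-! ### Implicit functions, the critical curve and the construction of the form -/

theorem ContinuousLinearMap.isInvertible_of_apply_one_ne_zero {A : ℝ →L[ℝ] ℝ} (hA : A 1 ≠ 0) :
    A.IsInvertible := by
  have h1 : ∀ x, A x = x * A 1 := fun x => by
    rw [← smul_eq_mul, ← map_smul, smul_eq_mul, mul_one]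
  refine ContinuousLinearMap.IsInvertible.of_inverse
    (g := (A 1)⁻¹ • ContinuousLinearMap.id ℝ ℝ) ?_ ?_
  · ext; simp [hA]
  · ext; simp [hA]

/-- The implicit function theorem for a smooth scalar equation in the plane. -/
theorem ContDiff.exists_implicit {G : ℝ × ℝ → ℝ} (hG : ContDiff ℝ ∞ G) (h0 : G 0 = 0)
    (h1 : fderiv ℝ G 0 (0, 1) ≠ 0) :
    ∃ ζ : ℝ → ℝ, ContDiff ℝ ∞ ζ ∧ ζ 0 = 0 ∧ ∀ᶠ t in 𝓝 (0 : ℝ), G (t, ζ t) = 0 := by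
  have hne : (∞ : WithTop ℕ∞) ≠ 0 := by simp
  have hinv : ∀ u, fderiv ℝ G u (0, 1) ≠ 0 →
      (fderiv ℝ G u ∘L .inr ℝ ℝ ℝ).IsInvertible := fun u hu =>
    ContinuousLinearMap.isInvertible_of_apply_one_ne_zero (by simpa using hu)
  have hGat : ∀ u, ContDiffAt ℝ ∞ G u := fun u => hG.contDiffAt
  set ζ := (hGat 0).implicitFunction hne (hinv 0 h1) with hζ
  have hζ0 : ζ 0 = 0 := (hGat 0).implicitFunction_apply_self hne (hinv 0 h1)
  have hζG : ∀ᶠ t in 𝓝 (0 : ℝ), G (t, ζ t) = 0 := by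
    have := (hGat 0).eventually_apply_implicitFunction hne (hinv 0 h1)
    rw [h0] at this
    exact this
  have hζd : ContDiffAt ℝ ∞ ζ 0 := (hGat 0).contDiffAt_implicitFunction hne (hinv 0 h1)
  have hcont : ∀ᶠ t in 𝓝 (0 : ℝ), ContinuousAt ζ t :=
    ((hζd.of_le (m := 1) (by simp)).eventually (by simp)).mono
      fun t ht => ht.continuousAt
  have hder : ∀ᶠ t in 𝓝 (0 : ℝ), fderiv ℝ G (t, ζ t) (0, 1) ≠ 0 := by
    have hc : ContinuousAt (fun t : ℝ => fderiv ℝ G (t, ζ t) (0, 1)) 0 := by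
      have h3 : Continuous fun u => fderiv ℝ G u (0, 1) := by
        have := (hG.fderiv_right (m := ∞) (by simp)).continuous
        fun_prop
      exact h3.continuousAt.comp (continuousAt_id.prodMk hζd.continuousAt)
    refine hc.eventually_ne ?_
    rw [hζ0]
    exact h1
  -- `ContDiffAt` of order `∞` at one point does not provide a common neighbourhood for all finite
  -- orders. The implicit function theorem is reapplied at nearby points of the curve, where local
  -- uniqueness identifies the solution with `ζ`.
  have hsm : SmoothNear ζ 0 := by
    refine smoothNear_of_eventually ?_
    filter_upwards [hcont, hder, hζG, hζG.eventually_nhds] with t htc htd ht0 htG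
    have h4 := (hGat (t, ζ t)).eventually_apply_eq_iff_implicitFunction hne (hinv _ htd)
    have h5 : Tendsto (fun s : ℝ => (s, ζ s)) (𝓝 t) (𝓝 (t, ζ t)) := continuousAt_id.prodMk htc
    refine ((hGat (t, ζ t)).contDiffAt_implicitFunction hne (hinv _ htd)).congr_of_eventuallyEq ?_
    filter_upwards [h5.eventually h4, htG] with s hs hs0
    exact (hs.1 (by rw [hs0, ht0])).symm
  obtain ⟨ζ', hζ', heq⟩ := hsm.exists_contDiff
  refine ⟨ζ', hζ', by rw [← heq.self_of_nhds, hζ0], ?_⟩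
  filter_upwards [heq, hζG] with t h2 h3
  rw [← h2, h3]

theorem SmoothNear.hasLead_cubic {φ : ℝ × ℝ → ℝ} (hφ : SmoothNear φ 0)
    (h2 : ∀ i j, i + j ≤ 2 → taylorCoeffAtZero φ (i, j) = 0) :
    HasLead φ 1 1 3 (fun x => taylorCoeffAtZero φ (3, 0) * x.1 ^ 3 +
      taylorCoeffAtZero φ (2, 1) * x.1 ^ 2 * x.2 + taylorCoeffAtZero φ (1, 2) * x.1 * x.2 ^ 2 +
      taylorCoeffAtZero φ (0, 3) * x.2 ^ 3) := by
  refine (hφ.hasLead_weightedPart one_pos one_pos fun i j hij => h2 i j (by omega)).congr_lead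
    fun x => ?_
  simp [weightedPart, Finset.sum_range_succ]
  ring

theorem partialAtZero_fderiv_snd {F : ℝ × ℝ → ℝ} (hF : ContDiff ℝ ∞ F) (i j : ℕ) :
    partialAtZero i j (fun x => fderiv ℝ F x (0, 1)) = partialAtZero i (j + 1) F := by
  simp only [partialAtZero]
  congr 1
  funext s
  rw [iteratedDeriv_succ']
  congr 1
  funext t
  exact ((hF.differentiable (by simp) (s, t)).hasFDerivAt.comp_hasDerivAt t
    ((hasDerivAt_const t s).prodMk (hasDerivAt_id t))).deriv.symm

theorem iteratedDeriv_fst_eq_zero_of_partialAtZero {f : ℝ × ℝ → ℝ} {i : ℕ}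
    (h : partialAtZero i 0 f = 0) : iteratedDeriv i (fun s => f (s, 0)) 0 = 0 := by
  simpa [partialAtZero] using h

/-- The critical curve `∂₂F(x₁, ψ(x₁)) = 0` of a function with cubic part `c x₁ x₂² + c' x₂³`. -/
theorem ContDiff.exists_critical_curve {F : ℝ × ℝ → ℝ} (hF : ContDiff ℝ ∞ F)
    (h2 : ∀ i j, i + j ≤ 2 → taylorCoeffAtZero F (i, j) = 0)
    (h21 : taylorCoeffAtZero F (2, 1) = 0) (h12 : taylorCoeffAtZero F (1, 2) ≠ 0) :
    ∃ ζ : ℝ → ℝ, ContDiff ℝ ∞ ζ ∧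
      ∀ᶠ t in 𝓝 (0 : ℝ), fderiv ℝ F (t, t ^ 2 * ζ t) (0, 1) = 0 := by
  set h : ℝ × ℝ → ℝ := fun x => fderiv ℝ F x (0, 1) with hh
  have hsm : ContDiff ℝ ∞ h := by
    have := hF.fderiv_right (m := ∞) (by simp)
    fun_prop
  have hc : ∀ i j, taylorCoeffAtZero F (i, j + 1) = 0 ↔ taylorCoeffAtZero h (i, j) = 0 := by
    intro i j
    rw [taylorCoeffAtZero_eq_zero_iff, taylorCoeffAtZero_eq_zero_iff, hh,
      partialAtZero_fderiv_snd hF]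
  obtain ⟨g, hg, hgh⟩ := exists_eq_add_snd_mul hsm
  obtain ⟨q, hq, hqg⟩ := exists_eq_add_snd_mul hg
  have hcg : ∀ i j, taylorCoeffAtZero h (i, j + 1) = taylorCoeffAtZero g (i, j) :=
    taylorCoeffAtZero_succ_snd hg (k := fun s => h (s, 0)) hgh
  obtain ⟨k, hk, hhk, hk0⟩ := ContDiff.exists_eq_pow_mul (f := fun s => h (s, 0)) (by fun_prop)
    (N := 2) fun i hi => iteratedDeriv_fst_eq_zero_of_partialAtZero
      (taylorCoeffAtZero_eq_zero_iff.1 ((hc i 0).1 (h2 i 1 (by omega))))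
  rw [← taylorCoeffAtZero_fst, (hc 2 0).1 h21] at hk0
  obtain ⟨l, hl, hgl, hl0⟩ := ContDiff.exists_eq_pow_mul (f := fun s => g (s, 0)) (by fun_prop)
    (N := 1) fun i hi => by
      obtain rfl : i = 0 := by omega
      refine iteratedDeriv_fst_eq_zero_of_partialAtZero (taylorCoeffAtZero_eq_zero_iff.1 ?_)
      rw [← hcg, ← hc]
      exact h2 0 2 le_rfl
  rw [← taylorCoeffAtZero_fst, ← hcg] at hl0
  have hl0' : l 0 ≠ 0 := by
    rw [hl0]
    exact fun h' => h12 ((hc 1 1).2 h')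
  -- The implicit function theorem does not apply to `∂₂F` directly, since its differential at the
  -- origin vanishes. The blow-up `x₂ = x₁ y` gives `∂₂F(x₁, x₁ y) = x₁² G(x₁, y)`, with `G(0) = 0`
  -- and `∂₂G(0) = l(0) ≠ 0`.
  set G : ℝ × ℝ → ℝ := fun x => k x.1 + x.2 * l x.1 + x.2 ^ 2 * q (x.1, x.1 * x.2) with hG
  have hGs : ContDiff ℝ ∞ G := by fun_prop
  have hG0 : G 0 = 0 := by simp [hG, hk0]
  have hGd : fderiv ℝ G 0 (0, 1) = l 0 := by
    rw [← (hGs.smoothNear 0).taylorCoeffAtZero_zero_one,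
      taylorCoeffAtZero_succ_snd (g := fun x => l x.1 + x.2 * q (x.1, x.1 * x.2)) (by fun_prop)
        (k := k) (fun x => by simp only [hG]; ring), taylorCoeffAtZero_zero_zero]
    simp
  obtain ⟨ζ, hζ, hζ0, hζG⟩ := hGs.exists_implicit hG0 (by rw [hGd]; exact hl0')
  -- The solution satisfies `ζ(0) = 0`, so a second factor `t` splits off and the curve is tangent
  -- to the axis.
  obtain ⟨ζ₁, hζ₁, hζζ⟩ := exists_eq_add_id_mul hζ
  refine ⟨ζ₁, hζ₁, hζG.mono fun t ht => ?_⟩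
  have e1 : t ^ 2 * ζ₁ t = t * ζ t := by rw [hζζ, hζ0]; ring
  have e2 := hgh (t, t * ζ t)
  have e3 := hqg (t, t * ζ t)
  have e4 := hhk t
  have e5 := hgl t
  simp only [hG] at ht
  simp only at e2 e3 e4 e5
  change h (t, t ^ 2 * ζ₁ t) = 0
  rw [e1, e2, e3, e4, e5]
  linear_combination t ^ 2 * ht

/-- The normal form of a smooth function with cubic part `c x₁ x₂²`, `c ≠ 0`. -/
theorem ContDiff.exists_isStdForm {F : ℝ × ℝ → ℝ} (hF : ContDiff ℝ ∞ F)
    (h2 : ∀ i j, i + j ≤ 2 → taylorCoeffAtZero F (i, j) = 0)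
    (h30 : taylorCoeffAtZero F (3, 0) = 0)
    (h21 : taylorCoeffAtZero F (2, 1) = 0) (h12 : taylorCoeffAtZero F (1, 2) ≠ 0)
    (h03 : taylorCoeffAtZero F (0, 3) = 0) :
    ∃ (b : ℝ × ℝ → ℝ) (ζ b₀ β : ℝ → ℝ), ContDiff ℝ ∞ b ∧ ContDiff ℝ ∞ ζ ∧ ContDiff ℝ ∞ b₀ ∧
      IsStdForm F b (fun t => t ^ 2 * ζ t) b₀ ∧ ContDiff ℝ ∞ β ∧ ∀ t, b₀ t = t ^ 4 * β t := by
  obtain ⟨ζ, hζ, hcrit⟩ := hF.exists_critical_curve h2 h21 h12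
  set ψ : ℝ → ℝ := fun t => t ^ 2 * ζ t with hψ
  have hψs : ContDiff ℝ ∞ ψ := by fun_prop
  have hl := (hF.smoothNear 0).hasLead_cubic h2
  simp only [h30, h21, h03, zero_mul, zero_add, add_zero] at hl
  set c := taylorCoeffAtZero F (1, 2)
  have hψl : HasLead (fun x : ℝ × ℝ => ψ x.1) 1 1 1 (fun _ => 0) :=
    ((HasLead.fst 1).comp_pow_mul (l := 1) one_pos one_pos continuous_fst.continuousAt rfl
      hζ.continuous.continuousAt (Eventually.of_forall fun t => rfl)).of_lt (by norm_num)
  set K : ℝ × ℝ → ℝ := fun x => F (x.1, x.2 + ψ x.1) with hK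
  have hKs : ContDiff ℝ ∞ K := by fun_prop
  have hKl : HasLead K 1 1 3 (fun x => c * x.1 * x.2 ^ 2) :=
    (hl.comp (HasLead.fst 1) ((HasLead.snd 1).add hψl)).congr_lead fun x => by ring
  have hKc2 := hKl.taylorCoeffAtZero_eq_zero (hKs.smoothNear 0) one_pos one_pos
  have hKc3 := fun i j hij => hKl.taylorCoeffAtZero_eq (hKs.smoothNear 0) one_pos one_pos
    (Polynomial.C c * Polynomial.X) (fun t => by simp) (i := i) (j := j) hij
  obtain ⟨A, hA, hKA⟩ := exists_eq_add_snd_mul hKs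
  obtain ⟨H, hH, hAH⟩ := exists_eq_add_snd_mul hA
  have hcH : ∀ i j, taylorCoeffAtZero H (i, j) = taylorCoeffAtZero K (i, j + 1 + 1) := by
    intro i j
    rw [taylorCoeffAtZero_succ_snd hA (k := fun s => K (s, 0)) hKA,
      taylorCoeffAtZero_succ_snd hH (k := fun s => A (s, 0)) hAH]
  -- `A(t, 0)` is `∂₂F` on the critical curve, so `K` has no term linear in `x₂` and `K = b₀(x₁) +
  -- x₂² H` near the origin.
  have hA0 : ∀ᶠ t in 𝓝 (0 : ℝ), A (t, 0) = 0 := by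
    filter_upwards [hcrit] with t ht
    have e1 : HasDerivAt (fun s : ℝ => K (t, s)) (fderiv ℝ F (t, ψ t) (0, 1)) 0 := by
      have e2 : HasDerivAt (fun s : ℝ => (t, s + ψ t)) ((0 : ℝ), (1 : ℝ)) 0 :=
        (hasDerivAt_const _ t).prodMk ((hasDerivAt_id (0 : ℝ)).add_const _)
      exact (hF.differentiable (by simp) (t, ψ t)).hasFDerivAt.comp_hasDerivAt_of_eq (0 : ℝ) e2
        (by simp)
    have e3 : HasDerivAt (fun s : ℝ => K (t, s)) (A (t, 0)) 0 := by
      have e4 : DifferentiableAt ℝ (fun s : ℝ => A (t, s)) 0 :=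
        ((hA.comp (contDiff_prodMk_right t)).differentiable (by simp)) 0
      have e5 := ((hasDerivAt_id (0 : ℝ)).mul e4.hasDerivAt).const_add (K (t, 0))
      simp only [id, one_mul, zero_mul, add_zero] at e5
      exact e5.congr_of_eventuallyEq (Eventually.of_forall fun s => hKA (t, s))
    rw [e3.unique e1, ht]
  set b₀ : ℝ → ℝ := fun t => K (t, 0) with hb₀
  have hb₀s : ContDiff ℝ ∞ b₀ := by fun_prop
  set b : ℝ × ℝ → ℝ := fun x => H (x.1, x.2 - ψ x.1) with hb
  have hbs : ContDiff ℝ ∞ b := by fun_prop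
  have hH0 : H 0 = 0 := by
    rw [← taylorCoeffAtZero_zero_zero H, hcH]
    exact hKc2 0 2 (by norm_num)
  have hbl : HasLead b 1 1 1 (fun x => c * x.1) := by
    refine (((hH.smoothNear 0).hasLead_linear hH0).comp (HasLead.fst 1)
      ((HasLead.snd 1).sub hψl)).congr_lead fun x => ?_
    rw [hcH, hcH, hKc3 1 2 (by norm_num), hKc3 0 3 (by norm_num)]
    simp
  have hbc := fun i j hij => hbl.taylorCoeffAtZero_eq (hbs.smoothNear 0) one_pos one_pos
    (Polynomial.C c * Polynomial.X) (fun t => by simp) (i := i) (j := j) hij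
  obtain ⟨β, hβ, hβeq, -⟩ := hb₀s.exists_eq_pow_mul (N := 4) fun i hi => by
    refine iteratedDeriv_fst_eq_zero_of_partialAtZero (taylorCoeffAtZero_eq_zero_iff.1 ?_)
    rcases (by omega : i < 3 ∨ i = 3) with h | rfl
    · exact hKc2 i 0 (by omega)
    · rw [hKc3 3 0 (by norm_num)]
      simp
  refine ⟨b, ζ, b₀, β, hbs, hζ, hb₀s, ⟨?_, hbs.smoothNear 0, hψs.smoothNear 0, hb₀s.smoothNear 0,
    ?_, ?_, ?_, ζ, hζ.continuous.continuousAt, Eventually.of_forall fun t => rfl⟩, hβ, hβeq⟩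
  · have h1 : Tendsto (fun x : ℝ × ℝ => x.1) (𝓝 0) (𝓝 0) := continuous_fst.tendsto (0 : ℝ × ℝ)
    filter_upwards [h1.eventually hA0] with x hx
    have e1 := hKA (x.1, x.2 - ψ x.1)
    have e2 := hAH (x.1, x.2 - ψ x.1)
    have e3 : K (x.1, x.2 - ψ x.1) = F x := by simp [hK]
    simp only [hx] at e2
    rw [← e3, e1, e2]
    simp only [hb, hb₀, hψ]
    ring
  · simpa [hb, hψ, Prod.mk_zero_zero] using hH0
  · rw [hbc 1 0 (by norm_num)]
    simpa using h12
  · rw [hbc 0 1 (by norm_num)]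
    simp

theorem ContDiff.finite_order_or_flat {f : ℝ → ℝ} (hf : ContDiff ℝ ∞ f) :
    (∃ (n : ℕ) (g : ℝ → ℝ), ContDiff ℝ ∞ g ∧ g 0 ≠ 0 ∧ ∀ t, f t = t ^ n * g t) ∨
      ∀ i, iteratedDeriv i f 0 = 0 := by
  classical
  by_cases h : ∃ i, iteratedDeriv i f 0 ≠ 0
  · left
    obtain ⟨g, hg, hfg, hg0⟩ := hf.exists_eq_pow_mul (N := Nat.find h)
      fun i hi => not_not.1 (Nat.find_min h hi)
    refine ⟨Nat.find h, g, hg, ?_, hfg⟩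
    rw [hg0]
    exact div_ne_zero (Nat.find_spec h) (by positivity)
  · right
    push Not at h
    exact h

/-- If `m < n`, division by `t^m` would give `f 0` as the limit of `t^(n-m) g t`, that is `0`. -/
theorem le_of_pow_mul_eventuallyEq {f g : ℝ → ℝ} {m n : ℕ} (hf : ContinuousAt f 0) (hf0 : f 0 ≠ 0)
    (hg : ContinuousAt g 0) (h : ∀ᶠ t in 𝓝 (0 : ℝ), t ^ m * f t = t ^ n * g t) : n ≤ m := by
  by_contra hlt
  have h1 : Tendsto f (𝓝[≠] 0) (𝓝 (f 0)) := hf.tendsto.mono_left nhdsWithin_le_nhds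
  have h2 : Tendsto (fun t => t ^ (n - m) * g t) (𝓝[≠] 0) (𝓝 0) := by
    have h3 : ContinuousAt (fun t => t ^ (n - m) * g t) 0 := by fun_prop
    have h4 := h3.tendsto
    rw [zero_pow (by omega), zero_mul] at h4
    exact h4.mono_left nhdsWithin_le_nhds
  refine hf0 (tendsto_nhds_unique (h1.congr' ?_) h2)
  filter_upwards [self_mem_nhdsWithin, nhdsWithin_le_nhds h] with t (ht : t ≠ 0) ht'
  have h5 : t ^ n = t ^ m * t ^ (n - m) := by rw [← pow_add]; congr 1; omega
  rw [h5, mul_assoc] at ht'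
  exact mul_left_cancel₀ (pow_ne_zero m ht) ht'

/-! ### Functions without an adapted linear coordinate system -/

/-- Smooth functions of height at most two, without terms of order at most two, for which no linear
coordinate system is adapted. -/
structure IsExceptional (φ : ℝ × ℝ → ℝ) : Prop where
  smooth : SmoothNear φ 0
  jet : ∀ i j, i + j ≤ 2 → taylorCoeffAtZero φ (i, j) = 0
  height_le : height φ ≤ 2
  lt : linHeight φ < height φ

namespace IsExceptional

variable {φ : ℝ × ℝ → ℝ}

theorem hasNormalForm_of_cubic (h : IsExceptional φ) (h30 : taylorCoeffAtZero φ (3, 0) = 0)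
    (h21 : taylorCoeffAtZero φ (2, 1) = 0) (h12 : taylorCoeffAtZero φ (1, 2) ≠ 0)
    (h03 : taylorCoeffAtZero φ (0, 3) = 0) : ∃ (m : ℕ) (n : ℕ∞), HasNormalForm φ m n := by
  obtain ⟨F, hF, hφF⟩ := h.smooth.exists_contDiff
  have hc := taylorCoeffAtZero_congr hφF
  obtain ⟨b, ζ, b₀, β, hb, hζ, hb₀, hS, hβ, hb4⟩ := hF.exists_isStdForm
    (fun i j hij => by rw [← hc, h.jet i j hij]) (by rw [← hc, h30]) (by rw [← hc, h21])
    (by rwa [← hc]) (by rw [← hc, h03])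
  have hS' : IsStdForm φ b (fun t => t ^ 2 * ζ t) b₀ :=
    { hS with eq := hφF.trans hS.eq }
  have hψ : ContDiff ℝ ∞ fun t => t ^ 2 * ζ t := by fun_prop
  have hflat : ∀ f : ℝ → ℝ, ContDiff ℝ ∞ f → (∀ i, iteratedDeriv i f 0 = 0) → ∀ N : ℕ,
      ∃ g : ℝ → ℝ, ContinuousAt g 0 ∧ ∀ᶠ t in 𝓝 (0 : ℝ), f t = t ^ N * g t := by
    intro f hf hf' N
    obtain ⟨g, hg, hfg, -⟩ := hf.exists_eq_pow_mul (N := N) fun i _ => hf' i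
    exact ⟨g, hg.continuous.continuousAt, Eventually.of_forall hfg⟩
  have key : ∀ (N M : ℕ) (γ w : ℝ → ℝ), 4 ≤ N → N ≤ 2 * M + 1 → ContinuousAt γ 0 → ContinuousAt w 0 →
      (∀ᶠ t in 𝓝 (0 : ℝ), b₀ t = t ^ N * γ t) → (∀ᶠ t in 𝓝 (0 : ℝ), t ^ 2 * ζ t = t ^ M * w t) →
      ENNReal.ofReal (2 * N / (N + 1)) ≤ linHeight φ := fun N M γ w hN hM hγ hw hbγ hψw =>
    hS'.le_linHeight hN hw hψw hM hγ hbγ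
  have hfin : ∀ (n : ℕ) (γ : ℝ → ℝ), ContDiff ℝ ∞ γ → γ 0 ≠ 0 → (∀ t, b₀ t = t ^ n * γ t) →
      4 ≤ n ∧ ¬ ENNReal.ofReal (2 * n / (n + 1)) ≤ linHeight φ := by
    intro n γ hγ hγ0 hbγ
    have hn : 4 ≤ n := le_of_pow_mul_eventuallyEq hγ.continuous.continuousAt hγ0
      hβ.continuous.continuousAt (Eventually.of_forall fun t => by rw [← hbγ, hb4])
    exact ⟨hn, fun hle => h.lt.not_ge ((hS'.height_le hγ.continuous.continuousAt hγ0
      (Eventually.of_forall hbγ) hn).trans hle)⟩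
  rcases hψ.finite_order_or_flat with ⟨m, w, hw, hw0, hψw⟩ | hψflat
  · have hm : 2 ≤ m := le_of_pow_mul_eventuallyEq hw.continuous.continuousAt hw0
      hζ.continuous.continuousAt (Eventually.of_forall fun t => (hψw t).symm)
    have hform : ∀ n : ℕ∞, ((2 * m + 1 : ℕ) : ℕ∞) < n → HasVanishingOrder b₀ n →
        HasNormalForm φ m n := by
      intro n hn hv
      refine ⟨ContinuousLinearEquiv.refl ℝ _, b, w, b₀, hb.smoothNear 0, hw.smoothNear 0,
        hb₀.smoothNear 0, hS'.eq.mono fun x hx => ?_, hS.b0,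
        fun h' => hS.b10 (taylorCoeffAtZero_eq_zero_iff.2 h'),
        taylorCoeffAtZero_eq_zero_iff.1 hS.b01, hm, hw0, hn, hv⟩
      rw [← hψw]
      exact hx
    rcases hb₀.finite_order_or_flat with ⟨n, γ, hγ, hγ0, hbγ⟩ | hbflat
    · obtain ⟨hn4, hn⟩ := hfin n γ hγ hγ0 hbγ
      refine ⟨m, n, hform n ?_ (Or.inl ⟨n, rfl, γ, hγ.smoothNear 0, hγ0, Eventually.of_forall hbγ⟩)⟩
      -- If `n ≤ 2m + 1`, the given linear coordinates already achieve `2n/(n+1)`, the upper bound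
      -- for the height.
      by_contra hlt
      have hle : n ≤ 2 * m + 1 := by exact_mod_cast not_lt.1 hlt
      exact hn (key n m γ w hn4 hle hγ.continuous.continuousAt hw.continuous.continuousAt
        (Eventually.of_forall hbγ) (Eventually.of_forall hψw))
    · exact ⟨m, ⊤, hform ⊤ (ENat.natCast_lt_top _) (Or.inr ⟨rfl, hbflat⟩)⟩
  · exfalso
    rcases hb₀.finite_order_or_flat with ⟨n, γ, hγ, hγ0, hbγ⟩ | hbflat
    · obtain ⟨hn4, hn⟩ := hfin n γ hγ hγ0 hbγ
      obtain ⟨w, hw, hψw⟩ := hflat _ hψ hψflat n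
      exact hn (key n n γ w hn4 (by omega) hγ.continuous.continuousAt hw
        (Eventually.of_forall hbγ) hψw)
    -- With both functions flat, the linear height is at least `2N/(N+1)` for every `N ≥ 4`, hence
    -- at least `2`.
    · refine h.lt.not_ge (h.height_le.trans (two_le_of_forall_two_mul_div_le fun N hN => ?_))
      obtain ⟨w, hw, hψw⟩ := hflat _ hψ hψflat N
      obtain ⟨γ, hγ, hbγ⟩ := hflat _ hb₀ hbflat N
      exact key N N γ w hN (by omega) hγ hw hbγ hψw

/-- The vanishing 2-jet leaves only exponents of total degree at least `3` to check, a short list in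
each use. -/
theorem le_linHeight_of_jet (h : IsExceptional φ) {p q l : ℕ} (hpq : 0 < p + q)
    (H : ∀ i j, 3 ≤ i + j → p * i + q * j < l → taylorCoeffAtZero φ (i, j) = 0) :
    ENNReal.ofReal ((l : ℝ) / (p + q)) ≤ linHeight φ := by
  refine (le_newtonDist hpq fun i j _ hij => ?_).trans (newtonDist_le_linHeight φ)
  rcases (by omega : i + j ≤ 2 ∨ 3 ≤ i + j) with h' | h'
  · exact h.jet i j h'
  · exact H i j h' hij

theorem not_le_linHeight (h : IsExceptional φ) {D : ℝ} (h1 : height φ ≤ ENNReal.ofReal D) :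
    ¬ ENNReal.ofReal D ≤ linHeight φ := fun h2 => h.lt.not_ge (h1.trans h2)

theorem comp_equiv (h : IsExceptional φ) (L : (ℝ × ℝ) ≃L[ℝ] (ℝ × ℝ)) :
    IsExceptional (fun x => φ (L x)) where
  smooth := SmoothNear.comp (f := φ) (by simpa using h.smooth) (L.contDiff.smoothNear 0)
  jet i j hij := ((h.smooth.hasLead_cubic h.jet).comp_linear (L.contDiff.smoothNear 0)
    (map_zero L)).taylorCoeffAtZero_eq_zero
      (SmoothNear.comp (f := φ) (by simpa using h.smooth) (L.contDiff.smoothNear 0))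
      one_pos one_pos i j (by omega)
  height_le := by rw [height_comp_equiv]; exact h.height_le
  lt := by rw [height_comp_equiv, linHeight_comp_equiv]; exact h.lt

theorem smooth_comp (h : IsExceptional φ) {X : ℝ × ℝ → ℝ × ℝ} (hX : IsLocalCoordinateChange X) :
    SmoothNear (fun x => φ (X x)) 0 :=
  SmoothNear.comp (f := φ) (by rw [hX.2.1]; exact h.smooth) hX.1

theorem coeff_cubic (h : IsExceptional φ) {X : ℝ × ℝ → ℝ × ℝ} (hX : IsLocalCoordinateChange X)
    {a b c d α β r s : ℝ} (ha : taylorCoeffAtZero φ (3, 0) = a)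
    (hb : taylorCoeffAtZero φ (2, 1) = b) (hc : taylorCoeffAtZero φ (1, 2) = c)
    (hd : taylorCoeffAtZero φ (0, 3) = d) (h1 : fderiv ℝ X 0 (1, 0) = (α, r))
    (h2 : fderiv ℝ X 0 (0, 1) = (β, s)) :
    taylorCoeffAtZero (fun x => φ (X x)) (3, 0) =
      a * α ^ 3 + b * α ^ 2 * r + c * α * r ^ 2 + d * r ^ 3 ∧
    taylorCoeffAtZero (fun x => φ (X x)) (2, 1) =
      3 * a * α ^ 2 * β + b * (2 * α * β * r + α ^ 2 * s) + c * (β * r ^ 2 + 2 * α * r * s)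
        + 3 * d * r ^ 2 * s ∧
    taylorCoeffAtZero (fun x => φ (X x)) (1, 2) =
      3 * a * α * β ^ 2 + b * (β ^ 2 * r + 2 * α * β * s) + c * (2 * β * r * s + α * s ^ 2)
        + 3 * d * r * s ^ 2 ∧
    taylorCoeffAtZero (fun x => φ (X x)) (0, 3) =
      a * β ^ 3 + b * β ^ 2 * s + c * β * s ^ 2 + d * s ^ 3 := by
  have hl := (h.smooth.hasLead_cubic h.jet).comp_linear hX.1 hX.2.1
  rw [ha, hb, hc, hd] at hl
  have hx : ∀ t : ℝ, fderiv ℝ X 0 (t, 1) = (α * t + β, r * t + s) := fun t => by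
    have : ((t, 1) : ℝ × ℝ) = t • ((1 : ℝ), (0 : ℝ)) + ((0 : ℝ), (1 : ℝ)) := by simp
    rw [this, map_add, map_smul, h1, h2]
    ext <;> simp [mul_comm]
  have key := fun i j hij => hl.taylorCoeffAtZero_eq (h.smooth_comp hX) one_pos one_pos
    (Polynomial.C (a * α ^ 3 + b * α ^ 2 * r + c * α * r ^ 2 + d * r ^ 3) * Polynomial.X ^ 3
      + Polynomial.C (3 * a * α ^ 2 * β + b * (2 * α * β * r + α ^ 2 * s)
        + c * (β * r ^ 2 + 2 * α * r * s) + 3 * d * r ^ 2 * s) * Polynomial.X ^ 2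
      + Polynomial.C (3 * a * α * β ^ 2 + b * (β ^ 2 * r + 2 * α * β * s)
        + c * (2 * β * r * s + α * s ^ 2) + 3 * d * r * s ^ 2) * Polynomial.X ^ 1
      + Polynomial.C (a * β ^ 3 + b * β ^ 2 * s + c * β * s ^ 2 + d * s ^ 3) * Polynomial.X ^ 0)
    (fun t => by
      simp only [hx, Polynomial.eval_add, Polynomial.eval_mul, Polynomial.eval_C,
        Polynomial.eval_pow, Polynomial.eval_X]
      ring) (i := i) (j := j) hij
  refine ⟨?_, ?_, ?_, ?_⟩ <;> rw [key _ _ (by norm_num)] <;>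
    simp only [Polynomial.coeff_add, Polynomial.coeff_C_mul, Polynomial.coeff_X_pow] <;> norm_num

/-- Some linear change of coordinates makes the first axis a multiple root of the cubic part. -/
theorem exists_multiple_root (h : IsExceptional φ) : ∃ L : (ℝ × ℝ) ≃L[ℝ] (ℝ × ℝ),
    taylorCoeffAtZero (fun x => φ (L x)) (3, 0) = 0 ∧
    taylorCoeffAtZero (fun x => φ (L x)) (2, 1) = 0 := by
  have hlow : ENNReal.ofReal (3 / 2) ≤ linHeight φ := by
    convert h.le_linHeight_of_jet (p := 1) (q := 1) (l := 3) (by norm_num)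
      fun i j h1 h2 => by omega using 2
    norm_num
  -- Some coordinates beat the linear height, hence `3/2`. The cubic part there depends only on the
  -- differential `A`, so `A`, possibly preceded by a swap, serves as the linear change.
  obtain ⟨X, hX'⟩ := lt_iSup_iff.1 h.lt
  obtain ⟨hX, hlt⟩ := lt_iSup_iff.1 hX'
  obtain ⟨A, hA⟩ := hX.2.2
  have h1 : fderiv ℝ X 0 (1, 0) = ((A (1, 0)).1, (A (1, 0)).2) := by rw [← hA]; rfl
  have h2 : fderiv ℝ X 0 (0, 1) = ((A (0, 1)).1, (A (0, 1)).2) := by rw [← hA]; rfl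
  obtain ⟨c30, c21, c12, c03⟩ := h.coeff_cubic hX rfl rfl rfl rfl h1 h2
  have hnot : ¬ newtonDist (fun x => φ (X x)) ≤ ENNReal.ofReal (3 / 2) := fun hle =>
    (hlow.trans_lt hlt).not_ge hle
  by_cases hc : taylorCoeffAtZero (fun x => φ (X x)) (3, 0) ≠ 0 ∨
      taylorCoeffAtZero (fun x => φ (X x)) (2, 1) ≠ 0
  · have hc' : ¬ (taylorCoeffAtZero (fun x => φ (X x)) (0, 3) ≠ 0 ∨
        taylorCoeffAtZero (fun x => φ (X x)) (1, 2) ≠ 0) := fun hc' =>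
      hnot (newtonDist_le_three_halves hc hc')
    push Not at hc'
    have h3 : fderiv ℝ ((ContinuousLinearEquiv.prodComm ℝ ℝ ℝ).trans A) 0 (1, 0) =
        ((A (0, 1)).1, (A (0, 1)).2) := by rw [ContinuousLinearEquiv.fderiv]; rfl
    have h4 : fderiv ℝ ((ContinuousLinearEquiv.prodComm ℝ ℝ ℝ).trans A) 0 (0, 1) =
        ((A (1, 0)).1, (A (1, 0)).2) := by rw [ContinuousLinearEquiv.fderiv]; rfl
    obtain ⟨d30, d21, -, -⟩ := h.coeff_cubic
      ((ContinuousLinearEquiv.prodComm ℝ ℝ ℝ).trans A).isLocalCoordinateChange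
      rfl rfl rfl rfl h3 h4
    refine ⟨(ContinuousLinearEquiv.prodComm ℝ ℝ ℝ).trans A, d30.trans ?_, d21.trans ?_⟩
    · linear_combination hc'.1 - c03
    · linear_combination hc'.2 - c12
  · push Not at hc
    have h3 : fderiv ℝ A 0 (1, 0) = ((A (1, 0)).1, (A (1, 0)).2) := by
      rw [ContinuousLinearEquiv.fderiv]; rfl
    have h4 : fderiv ℝ A 0 (0, 1) = ((A (0, 1)).1, (A (0, 1)).2) := by
      rw [ContinuousLinearEquiv.fderiv]; rfl
    obtain ⟨d30, d21, -, -⟩ := h.coeff_cubic A.isLocalCoordinateChange rfl rfl rfl rfl h3 h4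
    exact ⟨A, d30.trans (c30.symm.trans hc.1), d21.trans (c21.symm.trans hc.2)⟩

theorem isLocalCoordinateChange_comp_swap {X : ℝ × ℝ → ℝ × ℝ} (hX : IsLocalCoordinateChange X) :
    IsLocalCoordinateChange (fun x => X x.swap) ∧
      fderiv ℝ (fun x : ℝ × ℝ => X x.swap) 0 (1, 0) = fderiv ℝ X 0 (0, 1) := by
  obtain ⟨h1, h2, A, hA⟩ := hX
  have hd : HasFDerivAt (fun x : ℝ × ℝ => X x.swap)
      ((fderiv ℝ X 0).comp (ContinuousLinearEquiv.prodComm ℝ ℝ ℝ : ℝ × ℝ →L[ℝ] ℝ × ℝ)) 0 :=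
    HasFDerivAt.comp (g := X) (0 : ℝ × ℝ) (h1.contDiffAt.differentiableAt (by simp)).hasFDerivAt
      (ContinuousLinearEquiv.prodComm ℝ ℝ ℝ).hasFDerivAt
  refine ⟨⟨SmoothNear.comp (f := X) (x := (0 : ℝ × ℝ)) (u := Prod.swap) h1 smoothNear_swap, h2, ?_⟩,
    ?_⟩
  · rw [hd.fderiv, ← hA]
    exact ⟨(ContinuousLinearEquiv.prodComm ℝ ℝ ℝ).trans A, rfl⟩
  · rw [hd.fderiv]; rfl

/-- When the cubic part is a cube, it suffices to bound the Newton distance in coordinates that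
preserve the first axis to first order. -/
theorem height_le_of_triple (h : IsExceptional φ) (h30 : taylorCoeffAtZero φ (3, 0) = 0)
    (h21 : taylorCoeffAtZero φ (2, 1) = 0) (h12 : taylorCoeffAtZero φ (1, 2) = 0)
    (h03 : taylorCoeffAtZero φ (0, 3) ≠ 0) {D : ℝ} (hD : 3 / 2 ≤ D)
    (H : ∀ X : ℝ × ℝ → ℝ × ℝ, IsLocalCoordinateChange X → (fderiv ℝ X 0 (1, 0)).2 = 0 →
      newtonDist (fun x => φ (X x)) ≤ ENNReal.ofReal D) : height φ ≤ ENNReal.ofReal D := by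
  refine iSup₂_le fun X hX => ?_
  by_cases hr : (fderiv ℝ X 0 (1, 0)).2 = 0
  · exact H X hX hr
  by_cases hs : (fderiv ℝ X 0 (0, 1)).2 = 0
  · obtain ⟨h1, h2⟩ := isLocalCoordinateChange_comp_swap hX
    have := H _ h1 (by rw [h2, hs])
    rwa [(h.smooth_comp hX).newtonDist_swap] at this
  · obtain ⟨c30, -, -, c03⟩ := h.coeff_cubic (X := X) hX h30 h21 h12 rfl rfl rfl
    refine (newtonDist_le_three_halves (Or.inl ?_) (Or.inl ?_)).trans
      (ENNReal.ofReal_le_ofReal hD)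
    · change taylorCoeffAtZero (fun x => φ (X x)) (3, 0) ≠ 0
      rw [c30]
      simp [h03, hr]
    · change taylorCoeffAtZero (fun x => φ (X x)) (0, 3) ≠ 0
      rw [c03]
      simp [h03, hs]

/-- For weights `(1, 2)`, a coordinate change preserving the first axis to first order acts on
leading parts by the triangular map `(α x₁, s x₂ + δ x₁²)`. -/
theorem hasLead_coord (h : IsExceptional φ) {X : ℝ × ℝ → ℝ × ℝ} (hX : IsLocalCoordinateChange X)
    (hr : (fderiv ℝ X 0 (1, 0)).2 = 0) : ∃ α s δ : ℝ, α ≠ 0 ∧ s ≠ 0 ∧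
      (taylorCoeffAtZero φ (3, 0) = 0 → taylorCoeffAtZero φ (2, 1) = 0 →
        taylorCoeffAtZero φ (1, 2) = 0 → taylorCoeffAtZero (fun x => φ (X x)) (0, 3) =
          taylorCoeffAtZero φ (0, 3) * s ^ 3) ∧
      HasLead (fun x => (X x).1) 1 2 1 (fun x => α * x.1) ∧
      HasLead (fun x => (X x).2) 1 2 2 (fun x => s * x.2 + δ * x.1 ^ 2) := by
  have hd := (hX.1.contDiffAt.differentiableAt (by simp)).hasFDerivAt
  have e1 := hX.1.fst.taylorCoeffAtZero_one_zero
  have e2 := hX.1.snd.taylorCoeffAtZero_zero_one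
  have e3 := hX.1.snd.taylorCoeffAtZero_one_zero
  rw [hd.fst.fderiv] at e1
  rw [hd.snd.fderiv] at e2 e3
  obtain ⟨A, hA⟩ := hX.2.2
  have hdet := ContinuousLinearMap.det_ne_zero_of_injective (A := fderiv ℝ X 0)
    (by rw [← hA]; exact A.injective)
  rw [hr, mul_zero, sub_zero] at hdet
  have l1 := hX.1.fst.hasLead_fst (by simp [hX.2.1]) one_pos (q := 2) one_lt_two
  have l2 := hX.1.snd.hasLead_axis (N := 2) (p := 1) (q := 2) (fun i hi => by
    rcases (by omega : i = 0 ∨ i = 1) with rfl | rfl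
    · rw [taylorCoeffAtZero_zero_zero]; simp [hX.2.1]
    · rw [e3]; simpa using hr) one_pos two_pos le_rfl
  refine ⟨_, _, _, ?_, ?_, fun h30 h21 h12 => ?_, l1, l2⟩
  · rw [e1]; exact left_ne_zero_of_mul hdet
  · rw [e2]; exact right_ne_zero_of_mul hdet
  · rw [e2]
    obtain ⟨-, -, -, c03⟩ := h.coeff_cubic (X := X) hX h30 h21 h12 rfl rfl rfl
    rw [c03]
    simp

theorem false_of_triple (h : IsExceptional φ) (h30 : taylorCoeffAtZero φ (3, 0) = 0)
    (h21 : taylorCoeffAtZero φ (2, 1) = 0) (h12 : taylorCoeffAtZero φ (1, 2) = 0)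
    (h03 : taylorCoeffAtZero φ (0, 3) ≠ 0) : False := by
  have hlow : ∀ i j, i + 2 * j < 4 → taylorCoeffAtZero φ (i, j) = 0 := by
    intro i j hij
    rcases (by omega : i + j ≤ 2 ∨ (i = 3 ∧ j = 0)) with h' | ⟨rfl, rfl⟩
    · exact h.jet i j h'
    · exact h30
  have hl4 : HasLead φ 1 2 4 (fun x => taylorCoeffAtZero φ (4, 0) * x.1 ^ 4) := by
    refine (h.smooth.hasLead_weightedPart one_pos two_pos fun i j hij =>
      hlow i j (by omega)).congr_lead fun x => ?_
    simp [weightedPart, Finset.sum_range_succ, h21, h.jet 0 2 le_rfl]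
  -- Type E₆, `x₂³ + x₁⁴`: the triangular map keeps the coefficient of `x₁⁴` nonzero, and the height
  -- `12/7` is attained linearly.
  by_cases h40 : taylorCoeffAtZero φ (4, 0) = 0
  swap
  · refine h.not_le_linHeight (D := 12 / 7) (h.height_le_of_triple h30 h21 h12 h03 (by norm_num)
      fun X hX hr => ?_) ?_
    · obtain ⟨α, s, δ, hα, hs, c03, l1, l2⟩ := h.hasLead_coord hX hr
      have c40 := (hl4.comp l1 l2).taylorCoeffAtZero_eq (h.smooth_comp hX) one_pos two_pos
        (Polynomial.C (taylorCoeffAtZero φ (4, 0) * α ^ 4) * Polynomial.X ^ 4)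
        (fun t => by simp; ring) (i := 4) (j := 0) (by norm_num)
      rw [Polynomial.coeff_C_mul, Polynomial.coeff_X_pow, if_pos rfl, mul_one] at c40
      refine newtonDist_le (i := 0) (j := 3) (k := 4) (l := 0) ?_ ?_ (by norm_num) (by norm_num)
        (θ := 4 / 7) (by norm_num) (by norm_num) (by norm_num) (by norm_num)
      · rw [c03 h30 h21 h12]
        exact mul_ne_zero h03 (pow_ne_zero _ hs)
      · rw [c40]
        exact mul_ne_zero h40 (pow_ne_zero _ hα)
    · convert h.le_linHeight_of_jet (p := 3) (q := 4) (l := 12) (by norm_num)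
        fun i j h1 h2 => ?_ using 2
      · norm_num
      · rcases (by omega : (i = 3 ∧ j = 0) ∨ (i = 2 ∧ j = 1) ∨ (i = 1 ∧ j = 2)) with
          ⟨rfl, rfl⟩ | ⟨rfl, rfl⟩ | ⟨rfl, rfl⟩ <;> assumption
  have hlow5 : ∀ i j, i + 2 * j < 5 → taylorCoeffAtZero φ (i, j) = 0 := by
    intro i j hij
    rcases (by omega : i + j ≤ 2 ∨ (i = 3 ∧ j = 0) ∨ (i = 4 ∧ j = 0) ∨ (i = 2 ∧ j = 1)) with
      h' | ⟨rfl, rfl⟩ | ⟨rfl, rfl⟩ | ⟨rfl, rfl⟩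
    · exact h.jet i j h'
    all_goals assumption
  have hl5 : HasLead φ 1 2 5 (fun x => taylorCoeffAtZero φ (5, 0) * x.1 ^ 5 +
      taylorCoeffAtZero φ (3, 1) * (x.1 ^ 3 * x.2)) := by
    refine (h.smooth.hasLead_weightedPart one_pos two_pos fun i j hij =>
      hlow5 i j (by omega)).congr_lead fun x => ?_
    simp [weightedPart, Finset.sum_range_succ, h12]
  -- Type E₇, `x₂³ + x₁³ x₂`, with height `9/5`. It precedes `x₁⁵`, because `x₁³ x₂` contributes to
  -- the `x₁⁵` coefficient under the triangular map.
  by_cases h31 : taylorCoeffAtZero φ (3, 1) = 0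
  swap
  · refine h.not_le_linHeight (D := 9 / 5) (h.height_le_of_triple h30 h21 h12 h03 (by norm_num)
      fun X hX hr => ?_) ?_
    · obtain ⟨α, s, δ, hα, hs, c03, l1, l2⟩ := h.hasLead_coord hX hr
      have c31 := (hl5.comp l1 l2).taylorCoeffAtZero_eq (h.smooth_comp hX) one_pos two_pos
        (Polynomial.C (taylorCoeffAtZero φ (3, 1) * α ^ 3 * s) * Polynomial.X ^ 3 +
          Polynomial.C (taylorCoeffAtZero φ (5, 0) * α ^ 5 +
            taylorCoeffAtZero φ (3, 1) * α ^ 3 * δ) * Polynomial.X ^ 5)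
        (fun t => by simp; ring) (i := 3) (j := 1) (by norm_num)
      simp only [Polynomial.coeff_add, Polynomial.coeff_C_mul, Polynomial.coeff_X_pow] at c31
      norm_num at c31
      refine newtonDist_le (i := 0) (j := 3) (k := 3) (l := 1) ?_ ?_ (by norm_num) (by norm_num)
        (θ := 2 / 5) (by norm_num) (by norm_num) (by norm_num) (by norm_num)
      · rw [c03 h30 h21 h12]
        exact mul_ne_zero h03 (pow_ne_zero _ hs)
      · rw [c31]
        exact mul_ne_zero (mul_ne_zero h31 (pow_ne_zero _ hα)) hs
    · convert h.le_linHeight_of_jet (p := 2) (q := 3) (l := 9) (by norm_num)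
        fun i j h1 h2 => ?_ using 2
      · norm_num
      · rcases (by omega : (i = 1 ∧ j = 2) ∨ i + 2 * j < 5) with ⟨rfl, rfl⟩ | h'
        · exact h12
        · exact hlow5 i j h'
  -- Type E₈, `x₂³ + x₁⁵`, with height `15/8`.
  by_cases h50 : taylorCoeffAtZero φ (5, 0) = 0
  swap
  · refine h.not_le_linHeight (D := 15 / 8) (h.height_le_of_triple h30 h21 h12 h03 (by norm_num)
      fun X hX hr => ?_) ?_
    · obtain ⟨α, s, δ, hα, hs, c03, l1, l2⟩ := h.hasLead_coord hX hr
      have c50 := (hl5.comp l1 l2).taylorCoeffAtZero_eq (h.smooth_comp hX) one_pos two_pos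
        (Polynomial.C (taylorCoeffAtZero φ (5, 0) * α ^ 5) * Polynomial.X ^ 5)
        (fun t => by simp [h31]; ring) (i := 5) (j := 0) (by norm_num)
      rw [Polynomial.coeff_C_mul, Polynomial.coeff_X_pow, if_pos rfl, mul_one] at c50
      refine newtonDist_le (i := 0) (j := 3) (k := 5) (l := 0) ?_ ?_ (by norm_num) (by norm_num)
        (θ := 5 / 8) (by norm_num) (by norm_num) (by norm_num) (by norm_num)
      · rw [c03 h30 h21 h12]
        exact mul_ne_zero h03 (pow_ne_zero _ hs)
      · rw [c50]
        exact mul_ne_zero h50 (pow_ne_zero _ hα)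
    · convert h.le_linHeight_of_jet (p := 3) (q := 5) (l := 15) (by norm_num)
        fun i j h1 h2 => ?_ using 2
      · norm_num
      · rcases (by omega : (i = 3 ∧ j = 1) ∨ (i = 1 ∧ j = 2) ∨ i + 2 * j < 5) with
          ⟨rfl, rfl⟩ | ⟨rfl, rfl⟩ | h'
        · exact h31
        · exact h12
        · exact hlow5 i j h'
  -- Otherwise every exponent satisfies `i + 2j ≥ 6`, and the linear height is at least `6/3 = 2`.
  · refine h.not_le_linHeight (D := 2) (by simpa using h.height_le) ?_
    convert h.le_linHeight_of_jet (p := 1) (q := 2) (l := 6) (by norm_num)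
      fun i j h1 h2 => ?_ using 2
    · norm_num
    · rcases (by omega : (i = 3 ∧ j = 1) ∨ (i = 1 ∧ j = 2) ∨ (i = 5 ∧ j = 0) ∨ i + 2 * j < 5) with
        ⟨rfl, rfl⟩ | ⟨rfl, rfl⟩ | ⟨rfl, rfl⟩ | h'
      · exact h31
      · exact h12
      · exact h50
      · exact hlow5 i j h'

theorem false_of_cubic_eq_zero (h : IsExceptional φ) (h30 : taylorCoeffAtZero φ (3, 0) = 0)
    (h21 : taylorCoeffAtZero φ (2, 1) = 0) (h12 : taylorCoeffAtZero φ (1, 2) = 0)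
    (h03 : taylorCoeffAtZero φ (0, 3) = 0) : False := by
  refine h.not_le_linHeight (D := 2) (by simpa using h.height_le) ?_
  convert h.le_linHeight_of_jet (p := 1) (q := 1) (l := 4) (by norm_num)
    fun i j h1 h2 => ?_ using 2
  · norm_num
  · rcases (by omega : (i = 3 ∧ j = 0) ∨ (i = 2 ∧ j = 1) ∨ (i = 1 ∧ j = 2) ∨ (i = 0 ∧ j = 3)) with
      ⟨rfl, rfl⟩ | ⟨rfl, rfl⟩ | ⟨rfl, rfl⟩ | ⟨rfl, rfl⟩ <;> assumption

end IsExceptional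

/-! ### Assembling the theorem -/

theorem HasNormalForm.of_comp_equiv {φ : ℝ × ℝ → ℝ} {L : (ℝ × ℝ) ≃L[ℝ] (ℝ × ℝ)} {m : ℕ} {n : ℕ∞}
    (h : HasNormalForm (fun x => φ (L x)) m n) : HasNormalForm φ m n := by
  obtain ⟨L', rest⟩ := h
  exact ⟨L'.trans L, rest⟩

/-- The linear map `(x₁, x₂) ↦ (x₁ + c x₂, x₂)`. -/
noncomputable def horizontalShear (c : ℝ) : (ℝ × ℝ) ≃L[ℝ] (ℝ × ℝ) :=
  ContinuousLinearEquiv.equivOfInverse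
    ((ContinuousLinearMap.fst ℝ ℝ ℝ + c • ContinuousLinearMap.snd ℝ ℝ ℝ).prod
      (ContinuousLinearMap.snd ℝ ℝ ℝ))
    ((ContinuousLinearMap.fst ℝ ℝ ℝ - c • ContinuousLinearMap.snd ℝ ℝ ℝ).prod
      (ContinuousLinearMap.snd ℝ ℝ ℝ))
    (fun x => by ext <;> simp) (fun x => by ext <;> simp)

theorem horizontalShear_apply (c : ℝ) (x : ℝ × ℝ) :
    horizontalShear c x = (x.1 + c * x.2, x.2) := rfl

theorem IsExceptional.exists_hasNormalForm {φ : ℝ × ℝ → ℝ} (h : IsExceptional φ) :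
    ∃ (m : ℕ) (n : ℕ∞), HasNormalForm φ m n := by
  obtain ⟨L, h30, h21⟩ := h.exists_multiple_root
  have hL := h.comp_equiv L
  set f : ℝ × ℝ → ℝ := fun x => φ (L x)
  suffices H : ∃ (m : ℕ) (n : ℕ∞), HasNormalForm f m n by
    obtain ⟨m, n, H⟩ := H
    exact ⟨m, n, H.of_comp_equiv⟩
  by_cases h12 : taylorCoeffAtZero f (1, 2) = 0
  · by_cases h03 : taylorCoeffAtZero f (0, 3) = 0
    · exact (hL.false_of_cubic_eq_zero h30 h21 h12 h03).elim
    · exact (hL.false_of_triple h30 h21 h12 h03).elim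
  -- The cubic part is `x₂² (c₁₂ x₁ + c₀₃ x₂)`; this shear turns the simple factor into `c₁₂ x₁`.
  · set c := -(taylorCoeffAtZero f (0, 3) / taylorCoeffAtZero f (1, 2)) with hc
    have e1 : fderiv ℝ (horizontalShear c) 0 (1, 0) = (1, 0) := by
      rw [ContinuousLinearEquiv.fderiv]
      exact (horizontalShear_apply c (1, 0)).trans (by simp)
    have e2 : fderiv ℝ (horizontalShear c) 0 (0, 1) = (c, 1) := by
      rw [ContinuousLinearEquiv.fderiv]
      exact (horizontalShear_apply c (0, 1)).trans (by simp)
    obtain ⟨c30, c21, c12, c03⟩ := hL.coeff_cubic (horizontalShear c).isLocalCoordinateChange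
      h30 h21 rfl rfl e1 e2
    obtain ⟨m, n, H⟩ := (hL.comp_equiv (horizontalShear c)).hasNormalForm_of_cubic
      (by rw [c30]; simp) (by rw [c21]; simp) (by rw [c12]; simpa using h12)
      (by rw [c03, hc]; field_simp; ring)
    exact ⟨m, n, H.of_comp_equiv⟩

theorem mainTheorem8 (φ : ℝ × ℝ → ℝ) (hφ : SmoothNear φ 0) :
    ((∀ i j : ℕ, i + j ≤ 2 → partialAtZero i j φ = 0) → height φ ≤ 2 →
        linHeight φ < height φ →
      (∃ (m : ℕ) (n : ℕ∞), HasNormalForm φ m n) ∧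
      (∀ (m : ℕ) (n : ℕ∞), HasNormalForm φ m n →
        (∀ k : ℕ, n = (k : ℕ∞) → height φ = 2 * (k : ℝ≥0∞) / ((k : ℝ≥0∞) + 1)) ∧
        (n = ⊤ → height φ = 2) ∧
        linHeight φ = (2 * (m : ℝ≥0∞) + 1) / ((m : ℝ≥0∞) + 1))) ∧
    (∀ (m : ℕ) (n : ℕ∞), HasNormalForm φ m n →
      (∀ i j : ℕ, i + j ≤ 2 → partialAtZero i j φ = 0) ∧ height φ ≤ 2 ∧
        linHeight φ < height φ) := by
  refine ⟨fun h2 hle hlt => ⟨IsExceptional.exists_hasNormalForm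
    ⟨hφ, fun i j hij => taylorCoeffAtZero_eq_zero_iff.2 (h2 i j hij), hle, hlt⟩,
    fun m n h => ⟨?_, ?_, ?_⟩⟩, fun m n h => ⟨h.partialAtZero_eq_zero hφ, h.height_le_two_and_lt⟩⟩
  · rintro k rfl
    rw [h.height_eq_natCast, ofReal_two_mul_div]
  · rintro rfl
    exact h.height_eq_two
  · rw [h.linHeight_eq, ofReal_two_mul_div_odd]
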